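/- **Theorem.** A (real-time) deterministic push-down automaton (DPDA) is a tuple $M=(Q,\Sigma,\Gamma,\delta,\bot)$ with finite sets $Q\neq\emptyset$ (states), $\Sigma$ (input alphabet), $\Gamma$ (stack alphabet), a total function $\delta:Q\times\Sigma\times\Gamma\to Q\times\Gamma^*$ and a bottom symbol $\bot\in\Gamma$, such that whenever $\delta(q,a,x)=(q',v)$ and $\bot$ occurs in $v$, then $x=\bot$ and $\bot$ occurs in $v$ only as its first symbol. A configuration is a pair $(q,\upsilon)\in Q\times\Gamma^*$, the top of the stack being the right end of $\upsilon$; reading $a\in\Sigma$ leads from $(q,\upsilon x)$ to $(q',\upsilon v)$ if $\delta(q,a,x)=(q',v)$, and no letter can be read when the stack content is the empty word. A deterministic counter automaton (DCA) is a DPDA with $|\Gamma\setminus\{\bot\}|=1$. A word $w\in\Sigma^*$ synchronizes $M$ if there is a state $\overline q$ such that for every $q\in Q$ the run from $(q,\bot)$ on $w$ is defined and ends in a configuration $(\overline q,\upsilon_q)$ where, in the *empty* stack model, $\upsilon_q=\bot$ for all $q$; in the *same* stack model, $\upsilon_q=\upsilon_{q'}$ for all $q,q'$; and in the *arbitrary*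 stack model, the $\upsilon_q$ are unrestricted. The word $w$ is a 0-turn synchronizing word if, moreover, for every $q\in Q$ the run from $(q,\bot)$ on $w$ is a single stroke, that is, either none of its transitions decreases the stack height or none of its transitions increases it. For each of the three stack models, let 0-Turn-Sync-DPDA be the problem of deciding whether a given DPDA has a 0-turn synchronizing word in that model, and let 0-Turn-Sync-DCA be the same problem for a given DCA. Then 0-Turn-Sync-DCA is PSPACE-hard (under polynomial-time many-one reductions) in the empty, the same and the arbitrary stack model, and so is 0-Turn-Sync-DPDA. -/

import Mathlib

namespace SyncPDA

/-! ### Deterministic push-down automata -/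

/-- A (real-time) deterministic push-down automaton with state set `Q`, input alphabet `A` and
stack alphabet `G`, without initial and final states. The bottom symbol `bot` may be written only
as the lowest symbol of a word that replaces `bot` itself. -/
structure DPDA (Q A G : Type) where
  /-- the (total) transition function -/
  δ : Q → A → G → Q × List G
  /-- the stack bottom symbol -/
  bot : G
  bot_only_bottom : ∀ q a x, bot ∈ (δ q a x).2 →
    x = bot ∧ ∃ v : List G, (δ q a x).2 = bot :: v ∧ bot ∉ v

namespace DPDA

variable {Q A G : Type}

/-- A configuration: a state and a stack content, whose top is its right end. -/
abbrev Config (_M : DPDA Q A G) : Type := Q × List G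

/-- One transition: the top symbol `x` is replaced by the word `(δ q a x).2`. There is no
transition on the empty word as stack content (the bottom symbol has been removed). -/
def step (M : DPDA Q A G) (c : M.Config) (a : A) : Option M.Config :=
  match c.2.getLast? with
  | none => none
  | some x => some ((M.δ c.1 a x).1, c.2.dropLast ++ (M.δ c.1 a x).2)

/-- The configuration reached from `c` by reading a word (`none` if the computation gets stuck). -/
def run (M : DPDA Q A G) (c : M.Config) : List A → Option M.Config
  | [] => some c
  | a :: w => (M.step c a).bind fun c' => M.run c' w

/-- Reading the word from `c` is possible, and no transition decreases the stack height. -/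
def IsUpstroke (M : DPDA Q A G) (c : M.Config) : List A → Prop
  | [] => True
  | a :: w => ∃ c', M.step c a = some c' ∧ c.2.length ≤ c'.2.length ∧ M.IsUpstroke c' w

/-- Reading the word from `c` is possible, and no transition increases the stack height. -/
def IsDownstroke (M : DPDA Q A G) (c : M.Config) : List A → Prop
  | [] => True
  | a :: w => ∃ c', M.step c a = some c' ∧ c'.2.length ≤ c.2.length ∧ M.IsDownstroke c' w

/-- The sequence of configurations induced by `w` from `c` can be split into at most `k` strokes. -/
def AtMostStrokes (M : DPDA Q A G) : ℕ → M.Config → List A → Prop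
  | 0, _, w => w = []
  | k + 1, c, w => ∃ (u v : List A) (c' : M.Config), w = u ++ v ∧ M.run c u = some c' ∧
      (M.IsUpstroke c u ∨ M.IsDownstroke c u) ∧ M.AtMostStrokes k c' v

end DPDA

/-- The three conditions on the stack contents at the end of the runs. -/
inductive StackModel
  | empty
  | same
  | arbitrary

/-- The condition on the final stack contents `f q` of the runs started in the states `q`. -/
def StackModel.Holds {Q G : Type} (bot : G) (f : Q → List G) : StackModel → Prop
  | .empty => ∀ q, f q = [bot]
  | .same => ∀ q q', f q = f q'
  | .arbitrary => True

/-- `w` synchronizes `M` in the given stack model: all runs started with an empty stack (that is,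
containing the bottom symbol only) are defined and end in the same state `p`, and their final
stack contents satisfy the condition of the model. -/
def DPDA.Synchronizes {Q A G : Type} (M : DPDA Q A G) (model : StackModel) (w : List A) : Prop :=
  ∃ (p : Q) (f : Q → List G),
    (∀ q, M.run (q, [M.bot]) w = some (p, f q)) ∧ model.Holds M.bot f

/-- There is an `n`-turn synchronizing word for `M` in the given stack model. -/
def DPDA.HasTurnSyncWord {Q A G : Type} (M : DPDA Q A G) (n : ℕ) (model : StackModel) : Prop :=
  ∃ w : List A, M.Synchronizes model w ∧ ∀ q, M.AtMostStrokes (n + 1) (q, [M.bot]) w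

/-- A deterministic counter automaton: there is exactly one stack symbol besides the bottom. -/
def DPDA.IsDCA {Q A G : Type} (M : DPDA Q A G) : Prop :=
  {x : G | x ≠ M.bot}.ncard = 1

/-! ### The synchronization problems as languages over `{0,1}` -/

/-- An instance: a DPDA whose finite sets are initial segments of `ℕ`. -/
structure Instance where
  /-- number of states -/
  nQ : ℕ
  /-- number of input letters -/
  nA : ℕ
  /-- number of stack symbols -/
  nG : ℕ
  states_pos : 0 < nQ
  /-- the automaton -/
  M : DPDA (Fin nQ) (Fin nA) (Fin nG)

/-- The self-delimiting unary code `1ⁿ0` of a number. -/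
def unary (n : ℕ) : List Bool := List.replicate n true ++ [false]

/-- The code of a word over `Fin n`: its length, then its letters. -/
def encodeWord {n : ℕ} (v : List (Fin n)) : List Bool :=
  unary v.length ++ v.flatMap fun x : Fin n => unary x.val

/-- The code of an instance: the numbers of states, letters and stack symbols, the bottom symbol
and the table of the transition function, row by row. -/
def Instance.encode (I : Instance) : List Bool :=
  unary I.nQ ++ (unary I.nA ++ (unary I.nG ++ (unary I.M.bot.val ++
    (List.finRange I.nQ).flatMap fun q => (List.finRange I.nA).flatMap fun a =>
      (List.finRange I.nG).flatMap fun x =>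
        unary (I.M.δ q a x).1.val ++ encodeWord (I.M.δ q a x).2)))

theorem unary_append_inj {m n : ℕ} {s t : List Bool} (h : unary m ++ s = unary n ++ t) :
    m = n ∧ s = t := by
  induction m generalizing n with
  | zero =>
    cases n with
    | zero => simpa [unary] using h
    | succ n => simp [unary, List.replicate_succ] at h
  | succ m ih =>
    cases n with
    | zero => simp [unary, List.replicate_succ] at h
    | succ n =>
      have h' : unary m ++ s = unary n ++ t := by
        simpa [unary, List.replicate_succ] using h
      exact ⟨congrArg Nat.succ (ih h').1, (ih h').2⟩

theorem flatMap_append_inj {α : Type} {f g : α → List Bool} {P : α → Prop}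
    (hfg : ∀ a s t, f a ++ s = g a ++ t → P a ∧ s = t) (l : List α) {s t : List Bool}
    (h : l.flatMap f ++ s = l.flatMap g ++ t) : (∀ a ∈ l, P a) ∧ s = t := by
  induction l with
  | nil => simpa using h
  | cons a l ih =>
    simp only [List.flatMap_cons, List.append_assoc] at h
    obtain ⟨ha, h⟩ := hfg _ _ _ h
    obtain ⟨hl, h⟩ := ih h
    exact ⟨List.forall_mem_cons.2 ⟨ha, hl⟩, h⟩

theorem encodeWord_append_inj {n : ℕ} {v w : List (Fin n)} {s t : List Bool}
    (h₀ : encodeWord v ++ s = encodeWord w ++ t) : v = w ∧ s = t := by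
  rw [encodeWord, encodeWord, List.append_assoc, List.append_assoc] at h₀
  obtain ⟨hl, h⟩ := unary_append_inj h₀
  clear h₀
  induction v generalizing w with
  | nil =>
    obtain rfl := List.length_eq_zero_iff.1 hl.symm
    simpa using h
  | cons a v ih =>
    cases w with
    | nil => simp at hl
    | cons b w =>
      rw [List.flatMap_cons, List.flatMap_cons, List.append_assoc, List.append_assoc] at h
      obtain ⟨hab, h⟩ := unary_append_inj h
      obtain ⟨hv, hs⟩ := ih (by simpa using hl) h
      exact ⟨by rw [Fin.ext hab, hv], hs⟩

/-- Different instances have different codes. -/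
theorem Instance.encode_injective : Function.Injective Instance.encode := by
  rintro ⟨nQ, nA, nG, hQ, ⟨δ, bot, hb⟩⟩ ⟨nQ', nA', nG', hQ', ⟨δ', bot', hb'⟩⟩ h
  simp only [Instance.encode] at h
  obtain ⟨rfl, h⟩ := unary_append_inj h
  obtain ⟨rfl, h⟩ := unary_append_inj h
  obtain ⟨rfl, h⟩ := unary_append_inj h
  obtain ⟨hbot, h⟩ := unary_append_inj h
  obtain rfl := Fin.ext hbot
  have hx : ∀ q a x s t, (unary (δ q a x).1.val ++ encodeWord (δ q a x).2) ++ s =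
      (unary (δ' q a x).1.val ++ encodeWord (δ' q a x).2) ++ t → δ q a x = δ' q a x ∧ s = t := by
    intro q a x s t h
    rw [List.append_assoc, List.append_assoc] at h
    obtain ⟨h1, h⟩ := unary_append_inj h
    obtain ⟨h2, h⟩ := encodeWord_append_inj h
    exact ⟨Prod.ext (Fin.ext h1) h2, h⟩
  have ha := fun q a s t => flatMap_append_inj (hx q a) (List.finRange nG) (s := s) (t := t)
  have hq := fun q s t => flatMap_append_inj (ha q) (List.finRange nA) (s := s) (t := t)
  have key := (flatMap_append_inj hq (List.finRange nQ) (s := []) (t := []) (by simpa using h)).1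
  have : δ = δ' := by
    funext q a x
    exact key q (List.mem_finRange q) a (List.mem_finRange a) x (List.mem_finRange x)
  subst this
  rfl

/-- The problem `n`-Turn-Sync-DPDA in the given stack model. -/
def TurnSyncDPDA (n : ℕ) (model : StackModel) : Language Bool :=
  {s | ∃ I : Instance, I.encode = s ∧ I.M.HasTurnSyncWord n model}

/-- The problem `n`-Turn-Sync-DCA in the given stack model. -/
def TurnSyncDCA (n : ℕ) (model : StackModel) : Language Bool :=
  {s | ∃ I : Instance, I.encode = s ∧ I.M.IsDCA ∧ I.M.HasTurnSyncWord n model}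

/-! ### Polynomial space and polynomial-time reductions -/

/-- A deterministic one-tape Turing machine with a one-way infinite tape and input alphabet
`{0,1}`. It halts when `δ` is undefined. -/
structure DTM where
  /-- the states -/
  State : Type
  /-- the tape symbols -/
  Symbol : Type
  [stateFin : Fintype State]
  [symbolFin : Fintype Symbol]
  /-- the blank symbol -/
  blank : Symbol
  /-- the input letters as tape symbols -/
  input : Bool → Symbol
  input_injective : Function.Injective input
  input_ne_blank : ∀ b, input b ≠ blank
  /-- the initial state -/
  start : State
  /-- the accepting states -/
  accepting : Set State
  /-- the transition function: new state, symbol written, direction of the move -/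
  δ : State → Symbol → Option (State × Symbol × Turing.Dir)

namespace DTM

/-- A configuration: state, head position and tape content. -/
structure Config (T : DTM) where
  /-- the state -/
  state : T.State
  /-- the position of the head -/
  head : ℕ
  /-- the tape content -/
  tape : ℕ → T.Symbol

/-- The initial configuration: the input stands in the first cells, all others are blank. -/
def init (T : DTM) (x : List Bool) : T.Config where
  state := T.start
  head := 0
  tape i := (x[i]?).elim T.blank T.input

/-- The head moves by one cell; a move to the left in cell `0` leaves it there. -/
def moveHead : Turing.Dir → ℕ → ℕ
  | .left, i => i - 1
  | .right, i => i + 1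

/-- One computation step; `none` if the machine halts. -/
def step (T : DTM) (c : T.Config) : Option T.Config :=
  (T.δ c.state (c.tape c.head)).map fun r =>
    ⟨r.1, moveHead r.2.2 c.head, Function.update c.tape c.head r.2.1⟩

/-- `T` halts on every input, accepts exactly the words of `L`, and on inputs of length `n` scans
only the first `s n` cells. -/
def DecidesInSpace (T : DTM) (L : Language Bool) (s : ℕ → ℕ) : Prop :=
  ∀ x : List Bool,
    (∀ c, StateTransition.Reaches T.step (T.init x) c → c.head < s x.length) ∧
    ∃ c, StateTransition.Reaches T.step (T.init x) c ∧ T.step c = none ∧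
      (c.state ∈ T.accepting ↔ x ∈ L)

end DTM

/-- The class PSPACE. -/
def InPSPACE (L : Language Bool) : Prop :=
  ∃ (T : DTM) (p : Polynomial ℕ), T.DecidesInSpace L fun n => p.eval n

/-- Computability in polynomial time by a Turing machine (Mathlib's multi-stack machines). -/
def PolyTimeComputable (f : List Bool → List Bool) : Prop :=
  Nonempty (Turing.TM2ComputableInPolyTime (id : List Bool → List Bool) id f)

/-- Polynomial-time many-one reducibility. -/
def PolyTimeReducible (L K : Language Bool) : Prop :=
  ∃ f : List Bool → List Bool, PolyTimeComputable f ∧ ∀ x, x ∈ L ↔ f x ∈ K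

/-- PSPACE-hardness under polynomial-time many-one reductions. -/
def PSPACEHard (K : Language Bool) : Prop :=
  ∀ L : Language Bool, InPSPACE L → PolyTimeReducible L K

end SyncPDA

/-! Let `T` decide `L` in space `N`, a polynomial in the length of the input `x`. The reduction goes
through careful synchronization of a partial automaton. Its states are tokens, each recording either
the content of one cell or the head position together with the machine state, and one absorbing
sink. A restart letter sends every token to a token of the initial configuration. Any other letter
announces a situation (head position, state, scanned symbol). It is undefined on the head token if
position or state is wrong, and on the token of the announced cell if the symbol is wrong. So on the
tokens of a configuration only the true situation can be read, and reading it performs one step of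
`T`. Tokens are released into the sink only at an accepting halt. Hence some word is defined
everywhere and leads every state to the sink exactly if `T` accepts `x`
(`DTM.exists_simStep_sync_iff`).

A partial automaton becomes a counter automaton by letting undefined transitions pop the bottom
symbol and all others keep the stack. Successful runs then have constant stack `[0]`, so they are
single strokes and satisfy all three stack models at once. Conversely, the absorbing state forces
all runs of a synchronizing word to end in it, which no run that loses the bottom symbol does
(`partialDPDA_hasTurnSyncWord`). One construction thus serves all six claims.

It remains to write the instance in polynomial time. Since codes are unary, the transition table is
given by nested bounded loops around arithmetical expressions (`DTM.encode_simInstance`). Such terms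
are translated into stack programs with polynomial running time (`Exp.runs`, `Gen.runs`), and these
into multi-stack machines (`Runs.reachesIn`). -/

namespace SyncPDA

open Function (update)

/-! ### A structured language of stack programs -/

/-- The stacks of a program: input, output, an auxiliary stack, and two families of stacks that
hold natural numbers in unary. -/
inductive Reg
  | inp
  | out
  | tmp
  | var (v : ℕ)
  | wrk (j : ℕ)
  deriving DecidableEq

/-- The contents of all stacks. -/
abbrev Store : Type := Reg → List Bool

/-- Structured programs over stacks of bits. The loop `drain k p` pops the stack `k` until it is
empty and runs `p b` for each bit `b` it has popped; `case k p` branches on the top of `k`. -/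
inductive Prog
  | skip
  | push (k : Reg) (b : Bool)
  | pop (k : Reg)
  | seq (p q : Prog)
  | drain (k : Reg) (p : Bool → Prog)
  | case (k : Reg) (p : Option Bool → Prog)

/-- `Runs p S S' t`: the program `p` turns the store `S` into `S'` in at most `t` steps. -/
inductive Runs : Prog → Store → Store → ℕ → Prop
  | skip (S : Store) : Runs .skip S S 1
  | push (S : Store) (k : Reg) (b : Bool) :
      Runs (.push k b) S (Function.update S k (b :: S k)) 1
  | pop (S : Store) (k : Reg) : Runs (.pop k) S (Function.update S k (S k).tail) 1
  | seq {p q : Prog} {S S₁ S₂ : Store} {t₁ t₂ : ℕ} :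
      Runs p S S₁ t₁ → Runs q S₁ S₂ t₂ → Runs (.seq p q) S S₂ (t₁ + t₂)
  | drain_nil {k : Reg} {p : Bool → Prog} {S : Store} : S k = [] → Runs (.drain k p) S S 1
  | drain_cons {k : Reg} {p : Bool → Prog} {S S₁ S₂ : Store} {b : Bool} {l : List Bool}
      {t₁ t₂ : ℕ} : S k = b :: l → Runs (p b) (Function.update S k l) S₁ t₁ →
      Runs (.drain k p) S₁ S₂ t₂ → Runs (.drain k p) S S₂ (t₁ + t₂ + 1)
  | case {k : Reg} {p : Option Bool → Prog} {S S' : Store} {t : ℕ} :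
      Runs (p (S k).head?) S S' t → Runs (.case k p) S S' (t + 1)
  | mono {p : Prog} {S S' : Store} {t t' : ℕ} : Runs p S S' t → t ≤ t' → Runs p S S' t'

namespace Prog

/-- The stacks that a program mentions. -/
def regs : Prog → Finset Reg
  | skip => ∅
  | push k _ => {k}
  | pop k => {k}
  | seq p q => p.regs ∪ q.regs
  | drain k p => insert k (Finset.univ.biUnion fun b => (p b).regs)
  | case k p => insert k (Finset.univ.biUnion fun b => (p b).regs)

/-- The labels of the machine that runs a program. -/
def Lab : Prog → Type
  | skip => Unit
  | push _ _ => Unit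
  | pop _ => Unit
  | seq p q => p.Lab ⊕ q.Lab
  | drain _ p => Option (Σ b, (p b).Lab)
  | case _ p => Option (Σ b, (p b).Lab)

/-- The label at which a program starts. -/
def entry : (p : Prog) → p.Lab
  | skip => ()
  | push _ _ => ()
  | pop _ => ()
  | seq p _ => Sum.inl p.entry
  | drain _ _ => none
  | case _ _ => none

instance labFintype : (p : Prog) → Fintype p.Lab
  | skip => inferInstanceAs (Fintype Unit)
  | push _ _ => inferInstanceAs (Fintype Unit)
  | pop _ => inferInstanceAs (Fintype Unit)
  | seq p q =>
    have := labFintype p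
    have := labFintype q
    inferInstanceAs (Fintype (p.Lab ⊕ q.Lab))
  | drain _ p =>
    have := fun b => labFintype (p b)
    inferInstanceAs (Fintype (Option (Σ b, (p b).Lab)))
  | case _ p =>
    have := fun b => labFintype (p b)
    inferInstanceAs (Fintype (Option (Σ b, (p b).Lab)))

/-- Statements of the machines that run programs. -/
abbrev MStmt (R : Finset Reg) (Λ : Type) : Type :=
  Turing.TM2.Stmt (fun _ : R => Bool) Λ (Option Bool)

/-- The machine code of a program, whose labels are embedded by `f` into those of a larger machine,
and which ends with a jump to the label `e`. -/
def code (R : Finset Reg) {Λ : Type} : (p : Prog) → (p.Lab → Λ) → Λ → p.Lab → MStmt R Λ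
  | skip, _, e => fun _ => .goto fun _ => e
  | push k b, _, e => fun _ =>
    if h : k ∈ R then .push ⟨k, h⟩ (fun _ => b) (.goto fun _ => e) else .halt
  | pop k, _, e => fun _ =>
    if h : k ∈ R then .pop ⟨k, h⟩ (fun s _ => s) (.goto fun _ => e) else .halt
  | seq p q, f, e => fun l =>
    match (l : p.Lab ⊕ q.Lab) with
    | .inl l => p.code R (fun l => f (Sum.inl l)) (f (Sum.inr q.entry)) l
    | .inr l => q.code R (fun l => f (Sum.inr l)) e l
  | drain k p, f, e => fun l =>
    match (l : Option (Σ b, (p b).Lab)) with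
    | none =>
      if h : k ∈ R then
        .pop ⟨k, h⟩ (fun _ x => x)
          (.goto fun s => s.elim e fun b => f (some ⟨b, (p b).entry⟩))
      else .halt
    | some ⟨b, l⟩ => (p b).code R (fun l => f (some ⟨b, l⟩)) (f none) l
  | case k p, f, e => fun l =>
    match (l : Option (Σ b, (p b).Lab)) with
    | none =>
      if h : k ∈ R then
        .peek ⟨k, h⟩ (fun _ x => x) (.goto fun s => f (some ⟨s, (p s).entry⟩))
      else .halt
    | some ⟨b, l⟩ => (p b).code R (fun l => f (some ⟨b, l⟩)) e l

end Prog

/-! ### Correctness of the translation of programs into machines -/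

/-- The contents of the stacks in `R`. -/
def Store.res (R : Finset Reg) (S : Store) : R → List Bool := fun k => S k

theorem Store.update_res {R : Finset Reg} (S : Store) {k : Reg} (h : k ∈ R) (l : List Bool) :
    Function.update (S.res R) ⟨k, h⟩ l = Store.res R (Function.update S k l) := by
  funext r
  simp only [Store.res, Function.update_apply, Subtype.ext_iff]

/-- The machine `m` goes from one configuration to another in at most `t` steps. -/
def ReachesIn {R : Finset Reg} {Λ : Type} (m : Λ → Prog.MStmt R Λ)
    (c c' : Turing.TM2.Cfg (fun _ : R => Bool) Λ (Option Bool)) (t : ℕ) : Prop :=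
  ∃ n ≤ t, (flip bind (Turing.TM2.step m))^[n] (some c) = some c'

section ReachesIn

variable {R : Finset Reg} {Λ : Type} {m : Λ → Prog.MStmt R Λ}
  {c c' c'' : Turing.TM2.Cfg (fun _ : R => Bool) Λ (Option Bool)} {t t' : ℕ}

theorem ReachesIn.trans (h : ReachesIn m c c' t) (h' : ReachesIn m c' c'' t') :
    ReachesIn m c c'' (t + t') := by
  obtain ⟨n, hn, h⟩ := h
  obtain ⟨n', hn', h'⟩ := h'
  exact ⟨n' + n, by omega, by rw [Function.iterate_add_apply, h, h']⟩

theorem ReachesIn.single (h : Turing.TM2.step m c = some c') : ReachesIn m c c' 1 :=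
  ⟨1, le_rfl, h⟩

theorem ReachesIn.mono (h : ReachesIn m c c' t) (ht : t ≤ t') : ReachesIn m c c' t' :=
  h.imp fun _ h => ⟨h.1.trans ht, h.2⟩

end ReachesIn

/-- The embedding `f` and the exit label `e` are arbitrary, so that the induction applies to a
subprogram inside a larger machine. The internal memory may be anything at the start, because every
branching statement first overwrites it by a pop or a peek. -/
theorem Runs.reachesIn {R : Finset Reg} {p : Prog} {S S' : Store} {t : ℕ} (h : Runs p S S' t) :
    ∀ {Λ : Type} {m : Λ → Prog.MStmt R Λ} {f : p.Lab → Λ} {e : Λ},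
      (∀ l, m (f l) = p.code R f e l) → p.regs ⊆ R →
      ∀ v, ∃ v', ReachesIn m ⟨some (f p.entry), v, S.res R⟩ ⟨some e, v', S'.res R⟩ t := by
  induction h with
  | skip S =>
    intro Λ m f e hm _ v
    exact ⟨v, .single (by rw [Turing.TM2.step, hm]; rfl)⟩
  | push S k b =>
    intro Λ m f e hm hR v
    have hk : k ∈ R := hR (by simp [Prog.regs])
    refine ⟨v, .single ?_⟩
    rw [Turing.TM2.step, hm, Prog.code, dif_pos hk, ← Store.update_res S hk]
    rfl
  | pop S k =>
    intro Λ m f e hm hR v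
    have hk : k ∈ R := hR (by simp [Prog.regs])
    refine ⟨v, .single ?_⟩
    rw [Turing.TM2.step, hm, Prog.code, dif_pos hk, ← Store.update_res S hk]
    rfl
  | @seq p q S S₁ S₂ t₁ t₂ _ _ ihp ihq =>
    intro Λ m f e hm hR v
    rw [Prog.regs, Finset.union_subset_iff] at hR
    obtain ⟨v₁, h₁⟩ := ihp (fun l => hm (Sum.inl l)) hR.1 v
    obtain ⟨v₂, h₂⟩ := ihq (fun l => hm (Sum.inr l)) hR.2 v₁
    exact ⟨v₂, h₁.trans h₂⟩
  | @drain_nil k p S hS =>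
    intro Λ m f e hm hR v
    have hk : k ∈ R := hR (by simp [Prog.regs])
    refine ⟨none, .single ?_⟩
    have h0 : Function.update (S.res R) ⟨k, hk⟩ [] = S.res R := by
      rw [Store.update_res, ← hS, Function.update_eq_self]
    have h1 : S.res R ⟨k, hk⟩ = [] := hS
    rw [Turing.TM2.step, hm]
    simp [Prog.code, Prog.entry, hk, h1, h0]
  | @drain_cons k p S S₁ S₂ b l t₁ t₂ hS _ _ ih₁ ih₂ =>
    intro Λ m f e hm hR v
    have hk : k ∈ R := hR (by simp [Prog.regs])
    have hb : (p b).regs ⊆ R := fun r hr => hR (by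
      rw [Prog.regs, Finset.mem_insert, Finset.mem_biUnion]
      exact Or.inr ⟨b, Finset.mem_univ _, hr⟩)
    -- The body exits to the loop head `f none`, where the next bit is popped.
    obtain ⟨v₁, h₁⟩ := ih₁ (m := m) (f := fun l => f (some ⟨b, l⟩)) (e := f none)
      (fun l => (hm (some ⟨b, l⟩)).trans (by rw [Prog.code])) hb (some b)
    obtain ⟨v₂, h₂⟩ := ih₂ hm hR v₁
    refine ⟨v₂, ((ReachesIn.single ?_).trans (h₁.trans h₂)).mono (by omega)⟩
    have h1 : S.res R ⟨k, hk⟩ = b :: l := hS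
    rw [Turing.TM2.step, hm]
    simp [Prog.code, Prog.entry, hk, h1, Store.update_res]
  | @case k p S S' t _ ih =>
    intro Λ m f e hm hR v
    have hk : k ∈ R := hR (by simp [Prog.regs])
    have hb : (p (S k).head?).regs ⊆ R := fun r hr => hR (by
      rw [Prog.regs, Finset.mem_insert, Finset.mem_biUnion]
      exact Or.inr ⟨_, Finset.mem_univ _, hr⟩)
    obtain ⟨v₁, h₁⟩ := ih (m := m) (f := fun l => f (some ⟨_, l⟩)) (e := e)
      (fun l => (hm (some ⟨_, l⟩)).trans (by rw [Prog.code])) hb (S k).head?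
    refine ⟨v₁, ((ReachesIn.single ?_).trans h₁).mono (by omega)⟩
    rw [Turing.TM2.step, hm]
    simp [Prog.code, Prog.entry, hk, Store.res]
  | mono _ ht ih =>
    intro Λ m f e hm hR v
    obtain ⟨v', h⟩ := ih hm hR v
    exact ⟨v', h.mono ht⟩

/-! ### From programs to polynomial-time computability -/

/-- The store with a single nonempty stack. -/
def Store.single (k : Reg) (l : List Bool) : Store := Function.update (fun _ => []) k l

/-- The stacks of the machine that runs `p`. -/
def Prog.allRegs (p : Prog) : Finset Reg := insert .inp (insert .tmp p.regs)

/-- The machine that runs `p`, with input stack `inp` and output stack `tmp`. -/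
def Prog.machine (p : Prog) : Turing.FinTM2 where
  K := p.allRegs
  k₀ := ⟨.inp, by simp [Prog.allRegs]⟩
  k₁ := ⟨.tmp, by simp [Prog.allRegs]⟩
  Γ _ := Bool
  Λ := Option p.Lab
  main := some p.entry
  σ := Option Bool
  initialState := none
  Γk₀Fin := inferInstanceAs (Fintype Bool)
  -- This reset accounts for the summand 1 in the time bound `P + 1` below.
  -- The extra label resets the internal memory, as a halting configuration in the sense of
  -- `Turing.haltList` must carry the initial memory.
  m := fun l => l.elim (.load (fun _ => none) .halt) (p.code _ some none)

theorem Prog.polyTimeComputable (p : Prog) (g : List Bool → List Bool) (P : Polynomial ℕ)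
    (h : ∀ x, Runs p (.single .inp x) (.single .tmp (g x)) (P.eval x.length)) :
    PolyTimeComputable g := by
  classical
  refine ⟨⟨⟨p.machine, Equiv.refl _, Equiv.refl _⟩, P + 1, fun x => Classical.choice ?_⟩⟩
  have hm : ∀ l : p.Lab, p.machine.m (some l) = p.code p.allRegs some none l := fun _ => rfl
  obtain ⟨v, hv⟩ := (h x).reachesIn hm (fun r hr => by simp [Prog.allRegs, hr]) none
  have hlast : ReachesIn p.machine.m ⟨some none, v, (Store.single .tmp (g x)).res _⟩
      ⟨none, none, (Store.single .tmp (g x)).res _⟩ 1 := .single rfl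
  obtain ⟨n, hn, h⟩ := hv.trans hlast
  refine ⟨⟨⟨n, ?_⟩, by simpa using hn⟩⟩
  have hin : Turing.initList p.machine x =
      ⟨some (some p.entry), none, (Store.single .inp x).res p.allRegs⟩ := by
    simp only [Turing.initList, Prog.machine]
    congr 1
    funext r
    by_cases hr : r = ⟨.inp, by simp [Prog.allRegs]⟩
    · subst hr
      simp [Store.res, Store.single]
      rfl
    · have : r.1 ≠ .inp := fun h => hr (Subtype.ext h)
      simp [Store.res, Store.single, hr, this]
  have hout : Turing.haltList p.machine (g x) =
      ⟨none, none, (Store.single .tmp (g x)).res p.allRegs⟩ := by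
    simp only [Turing.haltList, Prog.machine]
    congr 1
    funext r
    by_cases hr : r = ⟨.tmp, by simp [Prog.allRegs]⟩
    · subst hr
      simp [Store.res, Store.single]
      rfl
    · have : r.1 ≠ .tmp := fun h => hr (Subtype.ext h)
      simp [Store.res, Store.single, hr, this]
  have hin' : Turing.initList p.machine (List.map (Equiv.refl Bool).invFun x) = _ :=
    (congrArg (Turing.initList p.machine) (List.map_id x)).trans hin
  have hout' : Turing.haltList p.machine (List.map (Equiv.refl Bool).invFun (g x)) = _ :=
    (congrArg (Turing.haltList p.machine) (List.map_id (g x))).trans hout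
  exact (congrArg (fun c => (flip bind (Turing.TM2.step p.machine.m))^[n] (some c)) hin').trans
    (h.trans (congrArg some hout'.symm))

/-! ### Basic program blocks -/

theorem Store.update_nil {S : Store} {k : Reg} (h : S k = []) : update S k [] = S := by
  rw [← h, Function.update_eq_self]

namespace Runs

theorem congr {p : Prog} {S S₁ S₂ : Store} {t₁ t₂ : ℕ} (h : Runs p S S₁ t₁) (ht : t₁ ≤ t₂)
    (hS : S₁ = S₂) : Runs p S S₂ t₂ :=
  hS ▸ h.mono ht

theorem transfer {k₁ k₂ : Reg} (h : k₁ ≠ k₂) {l : List Bool} {S : Store} (hl : S k₁ = l) :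
    Runs (.drain k₁ fun b => .push k₂ b) S
      (update (update S k₂ (l.reverse ++ S k₂)) k₁ []) (2 * l.length + 1) := by
  induction l generalizing S with
  | nil =>
    have e : update (update S k₂ (([] : List Bool).reverse ++ S k₂)) k₁ [] = S := by
      simp [Store.update_nil hl]
    rw [e]
    exact .drain_nil hl
  | cons b l ih =>
    refine Runs.congr (Runs.drain_cons hl (.push _ _ _) (ih (by simp [h]))) ?_ ?_
    · simp only [List.length_cons]; omega
    · funext r
      by_cases h₁ : r = k₁
      · simp [h₁]
      · by_cases h₂ : r = k₂ <;> simp [h₁, h₂, h.symm]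

theorem clear {k : Reg} {l : List Bool} {S : Store} (hl : S k = l) :
    Runs (.drain k fun _ => .skip) S (update S k []) (2 * l.length + 1) := by
  induction l generalizing S with
  | nil =>
    rw [Store.update_nil hl]
    exact .drain_nil hl
  | cons b l ih =>
    have := Runs.drain_cons hl (.skip _) (ih (Function.update_self ..))
    rw [Function.update_idem] at this
    exact this.mono (by simp only [List.length_cons]; omega)

theorem dup {k₁ k₂ k₃ : Reg} (h₁₂ : k₁ ≠ k₂) (h₁₃ : k₁ ≠ k₃) (h₂₃ : k₂ ≠ k₃) {l : List Bool}
    {S : Store} (hl : S k₁ = l) :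
    Runs (.drain k₁ fun b => .seq (.push k₂ true) (.push k₃ b)) S
      (update (update (update S k₂ (List.replicate l.length true ++ S k₂)) k₃
        (l.reverse ++ S k₃)) k₁ []) (3 * l.length + 1) := by
  induction l generalizing S with
  | nil =>
    have e : update (update (update S k₂ (List.replicate ([] : List Bool).length true ++ S k₂)) k₃
        (([] : List Bool).reverse ++ S k₃)) k₁ [] = S := by
      simp [Store.update_nil hl]
    rw [e]
    exact .drain_nil hl
  | cons b l ih =>
    refine Runs.congr (Runs.drain_cons hl (.seq (.push _ _ _) (.push _ _ _))
      (ih (by simp [h₁₂, h₁₃]))) ?_ ?_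
    · simp only [List.length_cons]; omega
    · funext r
      by_cases h₁ : r = k₁
      · simp [h₁]
      · by_cases h₂ : r = k₂
        · simp [h₂, h₁₂.symm, h₂₃, List.replicate_succ']
        · by_cases h₃ : r = k₃ <;> simp [h₁, h₂, h₃, h₁₃.symm, h₂₃.symm]

end Runs

/-- Adds the length of the stack `k₁` in unary to the stack `k₂`, using the empty stack `k₃`. -/
def Prog.copyLen (k₁ k₂ k₃ : Reg) : Prog :=
  .seq (.drain k₁ fun b => .seq (.push k₂ true) (.push k₃ b)) (.drain k₃ fun b => .push k₁ b)

theorem Runs.copyLen {k₁ k₂ k₃ : Reg} (h₁₂ : k₁ ≠ k₂) (h₁₃ : k₁ ≠ k₃) (h₂₃ : k₂ ≠ k₃)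
    {S : Store} (h₃ : S k₃ = []) :
    Runs (.copyLen k₁ k₂ k₃) S (update S k₂ (List.replicate (S k₁).length true ++ S k₂))
      (5 * (S k₁).length + 2) := by
  refine Runs.congr (Runs.seq (Runs.dup h₁₂ h₁₃ h₂₃ rfl)
    (Runs.transfer h₁₃.symm (l := (S k₁).reverse) (by simp [h₁₃.symm, h₃]))) ?_ ?_
  · simp only [List.length_reverse]; omega
  · funext r
    by_cases hr₃ : r = k₃
    · simp [hr₃, h₂₃.symm, h₃]
    · by_cases hr₁ : r = k₁
      · simp [hr₁, h₁₂, h₁₃]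
      · by_cases hr₂ : r = k₂ <;> simp [hr₁, hr₂, hr₃, h₁₂.symm, h₂₃]

/-- Adds the number `n` to the stack `k`. -/
def Prog.pushN (k : Reg) : ℕ → Prog
  | 0 => .skip
  | n + 1 => .seq (.push k true) (pushN k n)

theorem Runs.pushN (k : Reg) (n : ℕ) (S : Store) :
    Runs (.pushN k n) S (update S k (List.replicate n true ++ S k)) (n + 1) := by
  induction n generalizing S with
  | zero => exact Runs.congr (Runs.skip S) le_rfl (by simp)
  | succ n ih =>
    have := (Runs.push S k true).seq (ih _)
    rw [Function.update_idem, Function.update_self, ← List.singleton_append, ← List.append_assoc,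
      ← List.replicate_one, List.replicate_append_replicate] at this
    exact this.mono (by omega)

theorem Runs.drain_pop {k₁ k₂ : Reg} (h : k₁ ≠ k₂) {n : ℕ} {S : Store}
    (hn : S k₁ = List.replicate n true) :
    Runs (.drain k₁ fun _ => .pop k₂) S
      (update (update S k₂ ((S k₂).drop n)) k₁ []) (2 * n + 1) := by
  induction n generalizing S with
  | zero =>
    have e : update (update S k₂ ((S k₂).drop 0)) k₁ [] = S := by
      simp [Store.update_nil hn]
    rw [e]
    exact .drain_nil hn
  | succ n ih =>
    refine Runs.congr (Runs.drain_cons hn (.pop _ _) (ih (by simp [h]))) ?_ ?_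
    · omega
    · funext r
      by_cases h₁ : r = k₁
      · simp [h₁]
      · by_cases h₂ : r = k₂ <;> simp [h₁, h₂, h.symm]

/-- Moves one bit from the top of `k₁` to `k₂` if there is one. -/
def Prog.shift (k₁ k₂ : Reg) : Prog :=
  .case k₁ fun o => o.elim .skip fun b => .seq (.pop k₁) (.push k₂ b)

theorem Runs.shift {k₁ k₂ : Reg} (h : k₁ ≠ k₂) (S : Store) :
    Runs (.shift k₁ k₂) S
      (update (update S k₂ (((S k₁).take 1).reverse ++ S k₂)) k₁ ((S k₁).drop 1)) 3 := by
  refine Runs.case ?_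
  cases hl : S k₁ with
  | nil =>
    have e : update (update S k₂ ((([] : List Bool).take 1).reverse ++ S k₂)) k₁
        (([] : List Bool).drop 1) = S := by
      simp [Store.update_nil hl]
    rw [e]
    exact (Runs.skip S).mono (by omega)
  | cons b l =>
    refine Runs.congr ((Runs.pop S k₁).seq (.push _ k₂ b)) (by omega) ?_
    funext r
    by_cases h₁ : r = k₁
    · simp [h₁, h, hl]
    · by_cases h₂ : r = k₂ <;> simp [h₁, h₂, h.symm]

/-- This gives random access: it exposes position `n` of `k₁` and keeps the skipped prefix,
reversed, on `k₂`. If `n` exceeds the length, the superfluous shifts do nothing. -/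
theorem Runs.drain_shift {k k₁ k₂ : Reg} (h : k₁ ≠ k₂) (h₁ : k ≠ k₁) (h₂ : k ≠ k₂) {n : ℕ}
    {S : Store} (hn : S k = List.replicate n true) :
    Runs (.drain k fun _ => .shift k₁ k₂) S
      (update (update (update S k₂ (((S k₁).take n).reverse ++ S k₂)) k₁ ((S k₁).drop n)) k [])
      (4 * n + 1) := by
  induction n generalizing S with
  | zero =>
    have e : update (update (update S k₂ (((S k₁).take 0).reverse ++ S k₂)) k₁
        ((S k₁).drop 0)) k [] = S := by
      simp [Store.update_nil hn]
    rw [e]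
    exact .drain_nil hn
  | succ n ih =>
    refine Runs.congr (Runs.drain_cons hn (.shift h _) (ih (by simp [h₁, h₂]))) ?_ ?_
    · omega
    · funext r
      by_cases hr : r = k
      · simp [hr]
      · by_cases hr₁ : r = k₁
        · simp [hr₁, h₁.symm]
        · by_cases hr₂ : r = k₂
          · subst hr₂
            cases hS : S k₁ <;> simp [hr, hr₁, h₁.symm, hS]
          · simp [hr, hr₁, hr₂]

/-! ### Arithmetical expressions -/

/-- Arithmetical expressions in numerical variables and an input word. -/
inductive Exp
  | const (n : ℕ)
  | var (v : ℕ)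
  | len
  | inp (e : Exp)
  | add (e f : Exp)
  | sub (e f : Exp)
  | mul (e f : Exp)

/-- The code of an optional bit as a number. -/
def bitCode : Option Bool → ℕ
  | none => 0
  | some false => 1
  | some true => 2

namespace Exp

/-- The value of an expression; `inp e` is the code of the letter of the input at position `e`. -/
def eval (x : List Bool) (vars : ℕ → ℕ) : Exp → ℕ
  | const n => n
  | var v => vars v
  | len => x.length
  | inp e => bitCode x[e.eval x vars]?
  | add e f => e.eval x vars + f.eval x vars
  | sub e f => e.eval x vars - f.eval x vars
  | mul e f => e.eval x vars * f.eval x vars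

/-- The program that stores the value of an expression in `wrk k`. -/
def code : Exp → ℕ → Prog
  | const n, k => .pushN (.wrk k) n
  | var v, k => .copyLen (.var v) (.wrk k) .tmp
  | len, k => .copyLen .inp (.wrk k) .tmp
  | inp e, k => .seq (e.code k) (.seq (.drain (.wrk k) fun _ => .shift .inp .tmp)
      (.seq (.case .inp fun o => .pushN (.wrk k) (bitCode o)) (.drain .tmp fun b => .push .inp b)))
  | add e f, k => .seq (e.code k) (.seq (f.code (k + 1))
      (.drain (.wrk (k + 1)) fun b => .push (.wrk k) b))
  | sub e f, k => .seq (e.code k) (.seq (f.code (k + 1))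
      (.drain (.wrk (k + 1)) fun _ => .pop (.wrk k)))
  | mul e f, k => .seq (e.code k) (.seq (f.code (k + 1))
      (.seq (.drain (.wrk k) fun _ => .copyLen (.wrk (k + 1)) (.wrk (k + 2)) .tmp)
        (.seq (.drain (.wrk (k + 1)) fun _ => .skip)
          (.drain (.wrk (k + 2)) fun b => .push (.wrk k) b))))

end Exp

/-- The store `S` holds the input `x` and the values `vars` of the variables, and the working
stacks from number `k` on are empty. -/
structure Store.Ok (k : ℕ) (x : List Bool) (vars : ℕ → ℕ) (S : Store) : Prop where
  inp : S .inp = x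
  tmp : S .tmp = []
  var : ∀ v, S (.var v) = List.replicate (vars v) true
  wrk : ∀ j, k ≤ j → S (.wrk j) = []

theorem Store.Ok.update_wrk {k : ℕ} {x : List Bool} {vars : ℕ → ℕ} {S : Store}
    (h : S.Ok k x vars) (l : List Bool) : Store.Ok (k + 1) x vars (update S (.wrk k) l) where
  inp := by simp [h.inp]
  tmp := by simp [h.tmp]
  var v := by simp [h.var]
  wrk j hj := by
    have : j ≠ k := by omega
    simp [this, h.wrk j (by omega)]

theorem bitCode_le (o : Option Bool) : bitCode o ≤ 2 := by
  rcases o with _ | _ | _ <;> simp [bitCode]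

theorem Runs.drain_copyLen {k₀ k₁ k₂ k₃ : Reg} (h₀₁ : k₀ ≠ k₁) (h₀₂ : k₀ ≠ k₂) (h₀₃ : k₀ ≠ k₃)
    (h₁₂ : k₁ ≠ k₂) (h₁₃ : k₁ ≠ k₃) (h₂₃ : k₂ ≠ k₃) {S : Store} (h₃ : S k₃ = []) {n : ℕ}
    (hn : S k₀ = List.replicate n true) :
    Runs (.drain k₀ fun _ => .copyLen k₁ k₂ k₃) S
      (update (update S k₂ (List.replicate (n * (S k₁).length) true ++ S k₂)) k₀ [])
      (n * (5 * (S k₁).length + 3) + 1) := by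
  induction n generalizing S with
  | zero =>
    have e : update (update S k₂ (List.replicate (0 * (S k₁).length) true ++ S k₂)) k₀ [] = S := by
      simp [Store.update_nil hn]
    rw [e]
    exact (Runs.drain_nil hn).mono (by omega)
  | succ n ih =>
    refine Runs.congr (Runs.drain_cons hn (.copyLen h₁₂ h₁₃ h₂₃ (by simp [h₃, h₀₃.symm]))
      (ih (by simp [h₂₃.symm, h₃, h₀₃.symm]) (by simp [h₀₂]))) ?_ ?_
    · simp only [ne_eq, h₁₂, not_false_eq_true, Function.update_of_ne, h₀₁.symm, Nat.add_mul]
      omega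
    · funext r
      by_cases hr : r = k₀
      · simp [hr]
      · by_cases hr₂ : r = k₂
        · simp only [hr₂, h₁₂, h₀₁.symm, h₀₂.symm, Function.update_of_ne, Function.update_self,
            ne_eq, not_false_eq_true, ← List.append_assoc, List.replicate_append_replicate,
            Nat.add_mul, Nat.one_mul]
        · simp [hr, hr₂]

/-- The value must be bounded along with the time, since operations on unary numbers take time
growing with the values. One polynomial in a common bound `N` serves all inputs and variables, as
loop indices change while a term is evaluated. -/
theorem Exp.runs (e : Exp) : ∃ P : Polynomial ℕ, ∀ (N : ℕ) (x : List Bool) (vars : ℕ → ℕ),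
    x.length ≤ N → (∀ v, vars v ≤ N) → e.eval x vars ≤ P.eval N ∧
      ∀ (k : ℕ) (S : Store), S.Ok k x vars →
        Runs (e.code k) S (update S (.wrk k) (List.replicate (e.eval x vars) true))
          (P.eval N) := by
  induction e with
  | const n =>
    refine ⟨(n + 1 : ℕ), fun N x vars _ _ => ?_⟩
    simp only [Polynomial.eval_natCast, Nat.cast_id]
    refine ⟨by simp [eval], fun k S hS => ?_⟩
    exact Runs.congr (Runs.pushN (.wrk k) n S) le_rfl (by simp [hS.wrk, eval])
  | var v =>
    refine ⟨5 * Polynomial.X + 2, fun N x vars _ hv => ?_⟩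
    simp only [Polynomial.eval_add, Polynomial.eval_mul, Polynomial.eval_X, Polynomial.eval_ofNat]
    have := hv v
    refine ⟨by simp only [eval]; omega, fun k S hS => ?_⟩
    have := Runs.copyLen (k₁ := .var v) (k₂ := .wrk k) (by simp) (by simp) (by simp) hS.tmp
    simp only [hS.var, hS.wrk k le_rfl, List.length_replicate, List.append_nil] at this
    exact this.mono (by omega)
  | len =>
    refine ⟨5 * Polynomial.X + 2, fun N x vars hx _ => ?_⟩
    simp only [Polynomial.eval_add, Polynomial.eval_mul, Polynomial.eval_X, Polynomial.eval_ofNat]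
    refine ⟨by simp only [eval]; omega, fun k S hS => ?_⟩
    have := Runs.copyLen (k₁ := .inp) (k₂ := .wrk k) (by simp) (by simp) (by simp) hS.tmp
    simp only [hS.inp, hS.wrk k le_rfl, List.append_nil] at this
    exact this.mono (by omega)
  | inp e ih =>
    obtain ⟨P, h⟩ := ih
    refine ⟨P + 4 * P + 2 * Polynomial.X + 7, fun N x vars hx hv => ?_⟩
    obtain ⟨h₁, h₂⟩ := h N x vars hx hv
    simp only [Polynomial.eval_add, Polynomial.eval_mul, Polynomial.eval_X, Polynomial.eval_ofNat]
    have hb := bitCode_le x[e.eval x vars]?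
    refine ⟨by simp only [eval]; omega, fun k S hS => ?_⟩
    set a := e.eval x vars with ha
    -- The first `a` bits are parked on `tmp`, the bit then on top is decoded, and the parked bits
    -- are moved back.
    refine Runs.congr ((h₂ k S hS).seq ((Runs.drain_shift (k₁ := .inp) (k₂ := .tmp) (n := a)
      (by simp) (by simp) (by simp) (by simp)).seq ((Runs.case (Runs.pushN _ _ _)).seq
        (Runs.transfer (l := (x.take a).reverse) (by simp)
          (by simp [hS.inp, hS.tmp]))))) ?_ ?_
    · have : (x.drop a).head? = x[a]? := by simp [List.head?_drop]
      simp [hS.inp, this]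
      omega
    · funext r
      have : (x.drop a).head? = x[a]? := by simp [List.head?_drop]
      cases r with
      | wrk j => by_cases hj : j = k <;> simp [hS.inp, eval, ← ha, this, hj]
      | _ => simp [hS.inp, hS.tmp]
  | add e f ihe ihf =>
    obtain ⟨P, he⟩ := ihe
    obtain ⟨Q, hf⟩ := ihf
    refine ⟨P + 3 * Q + 1, fun N x vars hx hv => ?_⟩
    obtain ⟨h₁, h₂⟩ := he N x vars hx hv
    obtain ⟨h₃, h₄⟩ := hf N x vars hx hv
    simp only [Polynomial.eval_add, Polynomial.eval_mul, Polynomial.eval_one, Polynomial.eval_ofNat]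
    refine ⟨by simp only [eval]; omega, fun k S hS => ?_⟩
    refine Runs.congr ((h₂ k S hS).seq ((h₄ (k + 1) _ (hS.update_wrk _)).seq
      (Runs.transfer (by simp) (Function.update_self ..)))) ?_ ?_
    · simp only [List.length_replicate]; omega
    · funext r
      cases r with
      | wrk j =>
        by_cases hj : j = k + 1
        · simp [hj, hS.wrk]
        · by_cases hj' : j = k <;> simp [hj, hj', eval, Nat.add_comm]
      | _ => simp
  | sub e f ihe ihf =>
    obtain ⟨P, he⟩ := ihe
    obtain ⟨Q, hf⟩ := ihf
    refine ⟨P + 3 * Q + 1, fun N x vars hx hv => ?_⟩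
    obtain ⟨h₁, h₂⟩ := he N x vars hx hv
    obtain ⟨h₃, h₄⟩ := hf N x vars hx hv
    simp only [Polynomial.eval_add, Polynomial.eval_mul, Polynomial.eval_one, Polynomial.eval_ofNat]
    refine ⟨by simp only [eval]; omega, fun k S hS => ?_⟩
    refine Runs.congr ((h₂ k S hS).seq ((h₄ (k + 1) _ (hS.update_wrk _)).seq
      (Runs.drain_pop (by simp) (Function.update_self ..)))) ?_ ?_
    · omega
    · funext r
      cases r with
      | wrk j =>
        by_cases hj : j = k + 1
        · simp [hj, hS.wrk]
        · by_cases hj' : j = k <;> simp [hj, hj', eval]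
      | _ => simp
  | mul e f ihe ihf =>
    obtain ⟨P, he⟩ := ihe
    obtain ⟨Q, hf⟩ := ihf
    refine ⟨P + 3 * Q + P * (5 * Q + 3) + 2 * (P * Q) + 3, fun N x vars hx hv => ?_⟩
    obtain ⟨h₁, h₂⟩ := he N x vars hx hv
    obtain ⟨h₃, h₄⟩ := hf N x vars hx hv
    simp only [Polynomial.eval_add, Polynomial.eval_mul, Polynomial.eval_ofNat]
    have hmul := Nat.mul_le_mul h₁ h₃
    have hmul' : e.eval x vars * (5 * f.eval x vars + 3) ≤ P.eval N * (5 * Q.eval N + 3) := by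
      gcongr
    refine ⟨by simp only [eval]; omega, fun k S hS => ?_⟩
    refine Runs.congr ((h₂ k S hS).seq ((h₄ (k + 1) _ (hS.update_wrk _)).seq
      ((Runs.drain_copyLen (n := e.eval x vars) (by simp) (by simp) (by simp) (by simp) (by simp)
        (by simp) (by simp [hS.tmp]) (by simp)).seq
      ((Runs.clear (l := List.replicate (f.eval x vars) true) (by simp)).seq
      (Runs.transfer (l := List.replicate (e.eval x vars * f.eval x vars) true)
        (by simp) (by simp [hS.wrk])))))) ?_ ?_
    · simp only [List.length_replicate, Function.update_self]; omega
    · funext r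
      cases r with
      | wrk j =>
        by_cases hj : j = k + 2
        · simp [hj, hS.wrk]
        · by_cases hj₁ : j = k + 1
          · simp [hj₁, hS.wrk]
          · by_cases hj' : j = k <;> simp [hj, hj₁, hj', eval]
      | _ => simp

/-! ### Generators of words -/

/-- Terms for words that consist of unary codes of numbers and are built with bounded loops. -/
inductive Gen
  | unary (e : Exp)
  | nil
  | seq (g h : Gen)
  | loop (b : Exp) (g : Gen)

namespace Gen

/-- The word of a term at loop depth `d`; the index of a loop at depth `d` is the variable `d`. -/
def eval (x : List Bool) : Gen → ℕ → (ℕ → ℕ) → List Bool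
  | unary e, _, vars => SyncPDA.unary (e.eval x vars)
  | nil, _, _ => []
  | seq g h, d, vars => g.eval x d vars ++ h.eval x d vars
  | loop b g, d, vars =>
    (List.range (b.eval x vars)).flatMap fun i => g.eval x (d + 1) (update vars d i)

/-- The program that writes the word of a term at loop depth `d`. -/
def code : Gen → ℕ → Prog
  | unary e, d =>
    .seq (e.code d) (.seq (.drain (.wrk d) fun b => .push .out b) (.push .out false))
  | nil, _ => .skip
  | seq g h, d => .seq (g.code d) (h.code d)
  | loop b g, d => .seq (b.code d)
      (.seq (.drain (.wrk d) fun _ => .seq (g.code (d + 1)) (.push (.var d) true))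
        (.drain (.var d) fun _ => .skip))

end Gen

theorem Store.Ok.update_out {k : ℕ} {x : List Bool} {vars : ℕ → ℕ} {S : Store}
    (h : S.Ok k x vars) (l : List Bool) : Store.Ok k x vars (update S .out l) where
  inp := by simp [h.inp]
  tmp := by simp [h.tmp]
  var v := by simp [h.var]
  wrk j hj := by simp [h.wrk j hj]

/-- The invariant is `i + m = n`: `var d` counts the completed rounds, while `wrk d` holds the
number of rounds left. The working stacks from `d + 1` on are free for the body. -/
theorem Runs.drain_loop {p : Prog} {d n T : ℕ} {x : List Bool} {vars : ℕ → ℕ}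
    {f : ℕ → List Bool} (hp : ∀ i < n, ∀ S : Store, S.Ok (d + 1) x (update vars d i) →
      Runs p S (update S .out ((f i).reverse ++ S .out)) T) {m i : ℕ} (hi : i + m = n) {S : Store}
    (hS : S.Ok (d + 1) x (update vars d i)) (hm : S (.wrk d) = List.replicate m true) :
    Runs (.drain (.wrk d) fun _ => .seq p (.push (.var d) true)) S
      (update (update (update S .out (((List.range' i m).flatMap f).reverse ++ S .out)) (.wrk d) [])
        (.var d) (List.replicate n true)) (m * (T + 2) + 1) := by
  induction m generalizing i S with
  | zero =>
    refine Runs.congr (.drain_nil hm) (by omega) ?_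
    have := hS.var d
    rw [List.replicate_zero] at hm
    rw [Function.update_self, show i = n by omega] at this
    rw [List.range'_zero, List.flatMap_nil, List.reverse_nil, List.nil_append,
      Function.update_eq_self, Store.update_nil hm, ← this, Function.update_eq_self]
  | succ m ih =>
    have h₁ : Store.Ok (d + 1) x (update vars d i)
        (update S (.wrk d) (List.replicate m true)) :=
      { inp := by simp [hS.inp]
        tmp := by simp [hS.tmp]
        var := fun v => by simp [hS.var]
        wrk := fun j hj => by
          have : j ≠ d := by omega
          simp [this, hS.wrk j hj] }
    have h₂ := h₁.update_out ((f i).reverse ++ S .out)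
    have h₃ : Store.Ok (d + 1) x (update vars d (i + 1))
        (update (update (update S (.wrk d) (List.replicate m true)) .out
          ((f i).reverse ++ S .out)) (.var d) (true :: List.replicate i true)) :=
      { inp := by simp [hS.inp]
        tmp := by simp [hS.tmp]
        var := fun v => by
          by_cases hv : v = d
          · simp [hv, List.replicate_succ]
          · simp [hv, hS.var]
        wrk := fun j hj => by
          have : j ≠ d := by omega
          simp [this, hS.wrk j hj] }
    have hv : S (.var d) = List.replicate i true := by simp [hS.var]
    refine Runs.congr (Runs.drain_cons hm
      (.seq ((hp i (by omega) _ h₁)) (.push _ _ _)) (ih (i := i + 1) (by omega) ?_ ?_)) ?_ ?_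
    · simpa [hv] using h₃
    · simp
    · rw [Nat.add_mul]; omega
    · funext r
      cases r with
      | wrk j => by_cases hj : j = d <;> simp [hj]
      | var v => by_cases hj : v = d <;> simp [hj]
      | out => simp [List.range'_succ]
      | _ => simp

/-- The variables from `d` on vanish, so a loop at depth `d` finds its counter at 0 and needs no
initialisation; it clears the counter at the end. -/
theorem Gen.runs (g : Gen) (d : ℕ) : ∃ P : Polynomial ℕ, ∀ (N : ℕ) (x : List Bool) (vars : ℕ → ℕ),
    x.length ≤ N → (∀ v, vars v ≤ N) → (∀ v, d ≤ v → vars v = 0) →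
      ∀ S : Store, S.Ok d x vars →
        Runs (g.code d) S (update S .out ((g.eval x d vars).reverse ++ S .out)) (P.eval N) := by
  induction g generalizing d with
  | unary e =>
    obtain ⟨P, h⟩ := e.runs
    refine ⟨P + 2 * P + 2, fun N x vars hx hv _ S hS => ?_⟩
    obtain ⟨h₁, h₂⟩ := h N x vars hx hv
    simp only [Polynomial.eval_add, Polynomial.eval_mul, Polynomial.eval_ofNat]
    refine Runs.congr ((h₂ d S hS).seq ((Runs.transfer (by simp)
      (Function.update_self ..)).seq (Runs.push _ _ _))) ?_ ?_
    · simp only [List.length_replicate]; omega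
    · funext r
      cases r with
      | wrk j => by_cases hj : j = d <;> simp [hj, hS.wrk]
      | _ => simp [Gen.eval, SyncPDA.unary]
  | nil =>
    refine ⟨1, fun N x vars _ _ _ S _ => ?_⟩
    exact Runs.congr (Runs.skip S) (by simp) (by simp [Gen.eval])
  | seq g h ihg ihh =>
    obtain ⟨P, hP⟩ := ihg d
    obtain ⟨Q, hQ⟩ := ihh d
    refine ⟨P + Q, fun N x vars hx hv hd S hS => ?_⟩
    rw [Polynomial.eval_add]
    refine Runs.congr ((hP N x vars hx hv hd S hS).seq
      (hQ N x vars hx hv hd _ (hS.update_out _))) le_rfl ?_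
    simp [Gen.eval]
  | loop b g ih =>
    obtain ⟨P, hP⟩ := b.runs
    obtain ⟨Q, hQ⟩ := ih (d + 1)
    -- Inside the loop the index may exceed `N` but stays below `P.eval N`, so the body is run with
    -- the bound `N + P.eval N`.
    refine ⟨P + P * (Q.comp (Polynomial.X + P) + 2) + 2 * P + 2, fun N x vars hx hv hd S hS => ?_⟩
    obtain ⟨h₁, h₂⟩ := hP N x vars hx hv
    simp only [Polynomial.eval_add, Polynomial.eval_mul, Polynomial.eval_ofNat,
      Polynomial.eval_comp, Polynomial.eval_X]
    have h0 : update vars d 0 = vars := by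
      rw [← hd d le_rfl, Function.update_eq_self]
    have hbody : ∀ i < b.eval x vars, ∀ S : Store, S.Ok (d + 1) x (update vars d i) →
        Runs (g.code (d + 1)) S
          (update S .out ((g.eval x (d + 1) (update vars d i)).reverse ++ S .out))
          (Q.eval (N + P.eval N)) := by
      intro i hi S hS
      refine hQ (N + P.eval N) x _ (by omega) (fun v => ?_) (fun v hv => ?_) S hS
      · have := hv v
        by_cases hvd : v = d
        · simp only [hvd, Function.update_self]; omega
        · simp only [ne_eq, hvd, not_false_eq_true, Function.update_of_ne]; omega
      · have : v ≠ d := by omega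
        simp [this, hd v (by omega)]
    have hmul := Nat.mul_le_mul_right (Q.eval (N + P.eval N) + 2) h₁
    refine Runs.congr ((h₂ d S hS).seq ((Runs.drain_loop hbody (i := 0) (m := b.eval x vars)
      (by omega) (by rw [h0]; exact hS.update_wrk _) (by simp)).seq
      (Runs.clear (Function.update_self ..)))) ?_ ?_
    · simp only [List.length_replicate]; omega
    · funext r
      cases r with
      | wrk j => by_cases hj : j = d <;> simp [hj, hS.wrk]
      | var v => by_cases hj : v = d <;> simp [hj, hS.var, hd]
      | _ => simp [Gen.eval, List.range_eq_range']

/-- A step pushes at most one bit. Hence the time bound also bounds the output, and with it the cost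
of the final reversal. -/
theorem Runs.length_le {p : Prog} {S S' : Store} {t : ℕ} (h : Runs p S S' t) (k : Reg) :
    (S' k).length ≤ (S k).length + t := by
  induction h with
  | skip | drain_nil => omega
  | push S k' b =>
    by_cases hk : k = k'
    · simp [hk]
    · simp [hk]
  | pop S k' =>
    by_cases hk : k = k'
    · simp only [hk, Function.update_self, List.length_tail]; omega
    · simp [hk]
  | seq _ _ h₁ h₂ => omega
  | @drain_cons k' _ S _ _ b l _ _ hS _ _ h₁ h₂ =>
    have : (update S k' l k).length ≤ (S k).length := by
      by_cases hk : k = k'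
      · simp [hk, hS]
      · simp [hk]
    omega
  | case _ h => omega
  | mono _ _ h => omega

/-- Words given by terms are computable in polynomial time. -/
theorem Gen.polyTimeComputable (g : Gen) : PolyTimeComputable fun x => g.eval x 0 fun _ => 0 := by
  obtain ⟨P, hP⟩ := g.runs 0
  -- The word lies reversed on `out`; moving it to `tmp` puts it in order. The input is erased
  -- because only the output stack may be nonempty at the end.
  refine Prog.polyTimeComputable (.seq (g.code 0)
    (.seq (.drain .inp fun _ => .skip) (.drain .out fun b => .push .tmp b))) _
    (P + 2 * Polynomial.X + 2 * P + 2) fun x => ?_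
  have h := hP x.length x (fun _ => 0) le_rfl (by simp) (by simp) (.single .inp x)
    { inp := by simp [Store.single]
      tmp := by simp [Store.single]
      var := by simp [Store.single]
      wrk := by simp [Store.single] }
  have hlen := h.length_le .out
  simp only [Function.update_self, Store.single, ne_eq, reduceCtorEq, not_false_eq_true,
    Function.update_of_ne, List.append_nil, List.length_reverse, List.length_nil] at hlen
  refine Runs.congr (h.seq ((Runs.clear (l := x) (by simp [Store.single])).seq
    (Runs.transfer (by simp) (l := (g.eval x 0 fun _ => 0).reverse)
      (by simp [Store.single])))) ?_ ?_
  · simp only [Polynomial.eval_add, Polynomial.eval_mul, Polynomial.eval_ofNat, Polynomial.eval_X,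
      List.length_reverse]
    omega
  · funext r
    cases r <;> simp [Store.single]

/-! ### Carefully synchronizing words of partial automata -/

/-- The state reached from a state by a word in a partial automaton. -/
def partialRun {Q A : Type} (f : Q → A → Option Q) (q : Q) : List A → Option Q
  | [] => some q
  | a :: w => (f q a).bind fun q' => partialRun f q' w

/-- A partial automaton as a counter automaton: the undefined transitions remove the bottom symbol,
and the defined ones do not change the stack. -/
def partialDPDA {nQ nA : ℕ} (z : Fin nQ) (f : Fin nQ → Fin nA → Option (Fin nQ)) :
    DPDA (Fin nQ) (Fin nA) (Fin 2) where
  δ q a x := if x = 0 then (f q a).elim (z, []) fun q' => (q', [0]) else (z, [])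
  bot := 0
  bot_only_bottom q a x := by
    by_cases hx : x = 0
    · cases f q a <;> simp [hx]
    · simp [hx]

section partialDPDA

variable {nQ nA : ℕ} {z : Fin nQ} {f : Fin nQ → Fin nA → Option (Fin nQ)}

/-- The symbol 1 is never written; it is there only to make the number of non-bottom symbols equal
to one. -/
theorem partialDPDA_isDCA : (partialDPDA z f).IsDCA := by
  have : {x : Fin 2 | x ≠ 0} = {1} := by
    ext x
    fin_cases x <;> simp
  exact (congrArg Set.ncard this).trans (Set.ncard_singleton _)

theorem partialDPDA_step (q : Fin nQ) (a : Fin nA) :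
    (partialDPDA z f).step (q, [0]) a =
      some ((f q a).elim (z, []) fun q' => (q', [0])) := by
  cases h : f q a <;> simp [DPDA.step, partialDPDA, h]

theorem partialDPDA_run_of_partialRun {q q' : Fin nQ} {w : List (Fin nA)}
    (h : partialRun f q w = some q') :
    (partialDPDA z f).run (q, [0]) w = some (q', [0]) ∧
      (partialDPDA z f).IsUpstroke (q, [0]) w := by
  induction w generalizing q with
  | nil =>
    obtain rfl := Option.some.inj h
    exact ⟨rfl, trivial⟩
  | cons a w ih =>
    obtain ⟨q₁, h₁, h₂⟩ := Option.bind_eq_some_iff.1 h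
    have hs := partialDPDA_step (z := z) (f := f) q a
    rw [h₁] at hs
    obtain ⟨h₃, h₄⟩ := ih h₂
    exact ⟨by rw [DPDA.run, hs]; exact h₃, _, hs, le_rfl, h₄⟩

/-- Once the bottom symbol is popped, no further letter can be read. It can therefore be lost only
at the last letter, and then the run ends in `z`. -/
theorem partialRun_of_partialDPDA_run {q q' : Fin nQ} (hz : q' ≠ z) {w : List (Fin nA)}
    {s : List (Fin 2)} (h : (partialDPDA z f).run (q, [0]) w = some (q', s)) :
    partialRun f q w = some q' := by
  induction w generalizing q with
  | nil => exact congrArg some (congrArg Prod.fst (Option.some.inj h))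
  | cons a w ih =>
    rw [DPDA.run, partialDPDA_step] at h
    rw [partialRun]
    cases hf : f q a with
    | none =>
      rw [hf] at h
      cases w with
      | nil => exact absurd (congrArg Prod.fst (Option.some.inj h)).symm hz
      | cons b w => simp [DPDA.run, DPDA.step] at h
    | some q₁ =>
      rw [hf] at h
      exact ih h

theorem partialDPDA_hasTurnSyncWord {F : Fin nQ} (hF : F ≠ z) (hfix : ∀ a, f F a = some F)
    (model : StackModel) :
    (partialDPDA z f).HasTurnSyncWord 0 model ↔ ∃ w, ∀ q, partialRun f q w = some F := by
  constructor
  · rintro ⟨w, ⟨p, s, hw, -⟩, -⟩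
    have hFw : ∀ w, partialRun f F w = some F := by
      intro w
      induction w with
      | nil => rfl
      | cons a w ih => rw [partialRun, hfix]; exact ih
    have h := hw F
    rw [show (partialDPDA z f).bot = 0 from rfl,
      (partialDPDA_run_of_partialRun (hFw w)).1] at h
    -- The run from the absorbing state `F` determines the common final state.
    obtain rfl : F = p := congrArg Prod.fst (Option.some.inj h)
    exact ⟨w, fun q => partialRun_of_partialDPDA_run hF (hw q)⟩
  · rintro ⟨w, hw⟩
    refine ⟨w, ⟨F, fun _ => [0], fun q => (partialDPDA_run_of_partialRun (hw q)).1, ?_⟩,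
      fun q => ⟨w, [], _, by simp, (partialDPDA_run_of_partialRun (hw q)).1,
        Or.inl (partialDPDA_run_of_partialRun (hw q)).2, rfl⟩⟩
    cases model
    · exact fun _ => rfl
    · exact fun _ _ => rfl
    · trivial

end partialDPDA

theorem partialRun_equiv {Q Q' A A' : Type} (eQ : Q ≃ Q') (eA : A ≃ A') (f : Q → A → Option Q)
    (q : Q) (w : List A) :
    partialRun (fun q' a' => (f (eQ.symm q') (eA.symm a')).map eQ) (eQ q) (w.map eA) =
      (partialRun f q w).map eQ := by
  induction w generalizing q with
  | nil => rfl
  | cons a w ih =>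
    simp only [partialRun, List.map_cons, Equiv.symm_apply_apply]
    cases f q a with
    | none => rfl
    | some q₁ => exact ih q₁

theorem exists_partialRun_equiv {Q Q' A A' : Type} (eQ : Q ≃ Q') (eA : A ≃ A')
    (f : Q → A → Option Q) (F : Q) :
    (∃ w, ∀ q', partialRun (fun q' a' => (f (eQ.symm q') (eA.symm a')).map eQ) q' w =
      some (eQ F)) ↔ ∃ w, ∀ q, partialRun f q w = some F := by
  constructor
  · rintro ⟨w, hw⟩
    refine ⟨w.map eA.symm, fun q => ?_⟩
    have := hw (eQ q)
    rw [show w = (w.map eA.symm).map eA by simp, partialRun_equiv] at this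
    exact Option.map_injective eQ.injective this
  · rintro ⟨w, hw⟩
    refine ⟨w.map eA, fun q' => ?_⟩
    rw [← eQ.apply_symm_apply q', partialRun_equiv, hw]
    rfl

/-! ### The automaton of a space-bounded computation -/

namespace DTM

/-- The tokens of the automaton that simulates `T` on `N` cells: `(i, inl s)` says that cell `i`
contains `s`, and `(i, inr p)` that the head is in cell `i` and the state is `p`. -/
abbrev Token (T : DTM) (N : ℕ) : Type := Fin N × (T.Symbol ⊕ T.State)

/-- The letters of that automaton, besides the one for a restart: `(j, p, s)` says that the head is
in cell `j`, the state is `p` and the symbol read is `s`. -/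
abbrev Situation (T : DTM) (N : ℕ) : Type := Fin N × T.State × T.Symbol

open Classical in
/-- The partial automaton that simulates `T` on the input `x` and on `N` cells. The state `none` is
absorbing and reached when `T` accepts; the letter `none` is a restart. -/
noncomputable def simStep (T : DTM) (x : List Bool) (N : ℕ) :
    Option (T.Token N) → Option (T.Situation N) → Option (Option (T.Token N))
  | none, _ => some none
  | some (i, .inl _), none => some (some (i, .inl ((T.init x).tape i)))
  | some (i, .inr _), none => some (some (⟨0, i.pos⟩, .inr T.start))
  | some (i, .inl s'), some (j, p, s) =>
    if i = j then
      if s' = s then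
        some ((T.δ p s).elim none fun r => some (i, .inl r.2.1))
      else none
    else some ((T.δ p s).elim none fun _ => some (i, .inl s'))
  | some (i, .inr p'), some (j, p, s) =>
    if i = j ∧ p' = p then
      match T.δ p s with
      | none => if p ∈ T.accepting then some none else none
      | some r =>
        if h : moveHead r.2.2 i < N then some (some (⟨moveHead r.2.2 i, h⟩, .inr r.1)) else none
    else none

variable {T : DTM} {x : List Bool} {N : ℕ}

/-- All tokens of the configuration `c` are sent to the absorbing state by the word `w`. -/
def Collapses (T : DTM) (x : List Bool) (N : ℕ) (c : T.Config) (w : List (Option (T.Situation N))) :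
    Prop :=
  (∀ i : Fin N, partialRun (T.simStep x N) (some (i, .inl (c.tape i))) w = some none) ∧
    ∀ i : Fin N, i.val = c.head → partialRun (T.simStep x N) (some (i, .inr c.state)) w = some none

theorem partialRun_none (w : List (Option (T.Situation N))) :
    partialRun (T.simStep x N) none w = some none := by
  induction w with
  | nil => rfl
  | cons a w ih => rw [partialRun, simStep]; exact ih

/-- The word lists the situations of the computation in order; the last one, at the accepting halt,
sends all tokens to the sink. -/
theorem exists_collapses {c d : T.Config} (h : StateTransition.Reaches T.step c d)
    (hN : ∀ c', StateTransition.Reaches T.step c c' → c'.head < N) (hd : T.step d = none)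
    (hacc : d.state ∈ T.accepting) : ∃ w, T.Collapses x N c w := by
  induction h using Relation.ReflTransGen.head_induction_on with
  | refl =>
    have hδ : T.δ d.state (d.tape d.head) = none := by simpa [DTM.step] using hd
    have hh := hN d .refl
    refine ⟨[some (⟨d.head, hh⟩, d.state, d.tape d.head)], fun i => ?_, fun i hi => ?_⟩
    · by_cases hi : i = ⟨d.head, hh⟩
      · subst hi; simp [partialRun, simStep, hδ]
      · simp [partialRun, simStep, hδ, hi]
    · obtain rfl : i = ⟨d.head, hh⟩ := Fin.ext hi
      simp [partialRun, simStep, hδ, hacc]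
  | @head c c₁ hc _ ih =>
    obtain ⟨w, hw₁, hw₂⟩ := ih fun c' hc' => hN c' (.head hc hc')
    have hh := hN c .refl
    have hh₁ := hN c₁ (.single hc)
    obtain ⟨r, hr, rfl⟩ := Option.map_eq_some_iff.1 hc
    refine ⟨some (⟨c.head, hh⟩, c.state, c.tape c.head) :: w, fun i => ?_, fun i hi => ?_⟩
    · have := hw₁ i
      by_cases hi : i = ⟨c.head, hh⟩
      · subst hi; simpa [partialRun, simStep, hr] using this
      · have hi' : i.val ≠ c.head := fun h => hi (Fin.ext h)
        simpa [partialRun, simStep, hr, hi, hi'] using this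
    · obtain rfl : i = ⟨c.head, hh⟩ := Fin.ext hi
      have hh₁' : moveHead r.2.2 c.head < N := hh₁
      simpa [partialRun, simStep, hr, hh₁'] using hw₂ ⟨_, hh₁⟩ rfl

/-- By induction on the word, the tokens always follow a reachable configuration: a restart leads
back to the initial one, and a situation letter must be the true one, hence simulates a step or
witnesses acceptance. -/
theorem accepts_of_collapses
    (hN : ∀ c, StateTransition.Reaches T.step (T.init x) c → c.head < N)
    {w : List (Option (T.Situation N))} {c : T.Config}
    (hc : StateTransition.Reaches T.step (T.init x) c) (h : T.Collapses x N c w) :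
    ∃ d, StateTransition.Reaches T.step (T.init x) d ∧ T.step d = none ∧
      d.state ∈ T.accepting := by
  induction w generalizing c with
  | nil => simpa [partialRun] using h.1 ⟨_, hN c hc⟩
  | cons a w ih =>
    obtain ⟨h₁, h₂⟩ := h
    have hh := hN c hc
    rcases a with _ | ⟨j, p, s⟩
    · refine ih .refl ⟨fun i => h₁ i, fun i hi => ?_⟩
      have := h₂ ⟨_, hh⟩ rfl
      have hi' : i = ⟨0, (⟨c.head, hh⟩ : Fin N).pos⟩ := Fin.ext hi
      rw [hi']
      exact this
    · have h₃ := h₂ ⟨_, hh⟩ rfl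
      have h₄ := h₁ ⟨_, hh⟩
      simp only [partialRun, simStep] at h₃ h₄
      -- Definedness on the head token `h₃` forces the position and the state, and definedness on
      -- the scanned cell `h₄` forces the symbol.
      by_cases hjp : (⟨c.head, hh⟩ : Fin N) = j ∧ c.state = p
      · obtain ⟨rfl, rfl⟩ := hjp
        by_cases hs : c.tape c.head = s
        · subst hs
          cases hr : T.δ c.state (c.tape c.head) with
          | none =>
            rw [hr] at h₃
            by_cases hacc : c.state ∈ T.accepting
            · exact ⟨c, hc, by simp [DTM.step, hr], hacc⟩
            · simp [hacc] at h₃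
          | some r =>
            have hstep : T.step c = some ⟨r.1, moveHead r.2.2 c.head,
                Function.update c.tape c.head r.2.1⟩ := by
              simp [DTM.step, hr]
            refine ih (hc.tail hstep) ⟨fun i => ?_, fun i hi => ?_⟩
            · by_cases hi : i = ⟨c.head, hh⟩
              · subst hi; simpa [hr] using h₄
              · have hi' : i.val ≠ c.head := fun h => hi (Fin.ext h)
                simpa [partialRun, simStep, hr, hi, hi'] using h₁ i
            · have hi' : i.val = moveHead r.2.2 c.head := hi
              have hlt : moveHead r.2.2 c.head < N := hi' ▸ i.isLt
              obtain rfl : i = ⟨_, hlt⟩ := Fin.ext hi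
              simpa [hr, hlt] using h₃
        · simp [hs] at h₄
      · simp [hjp] at h₃

theorem exists_simStep_sync_iff {L : Language Bool} {s : ℕ → ℕ} (hT : T.DecidesInSpace L s) :
    (∃ w, ∀ q, partialRun (T.simStep x (s x.length)) q w = some none) ↔ x ∈ L := by
  obtain ⟨hN, d, hd, hd₀, hdL⟩ := hT x
  have hpos := hN _ .refl
  rw [← hdL]
  constructor
  · rintro ⟨w, hw⟩
    suffices ∃ d', StateTransition.Reaches T.step (T.init x) d' ∧ T.step d' = none ∧
        d'.state ∈ T.accepting by
      obtain ⟨d', h₁, h₂, h₃⟩ := this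
      -- By determinism only one halting configuration is reachable.
      have : d = d' := Part.mem_unique (StateTransition.mem_eval.2 ⟨hd, hd₀⟩)
        (StateTransition.mem_eval.2 ⟨h₁, h₂⟩)
      rwa [this]
    exact accepts_of_collapses hN .refl ⟨fun i => hw _, fun i _ => hw _⟩
  · intro hacc
    obtain ⟨w, hw₁, hw₂⟩ := exists_collapses (x := x) hd hN hd₀ hacc
    -- The restart sends every state to a token of the initial configuration or leaves it in the
    -- sink.
    refine ⟨none :: w, fun q => ?_⟩
    rcases q with _ | ⟨i, s | p⟩
    · exact partialRun_none _
    · exact hw₁ i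
    · exact hw₂ ⟨0, hpos⟩ rfl

end DTM

/-! ### Numbering pairs and an extra element -/

/-- The elements of `Fin N × C` are numbered row by row, the extra element comes last. -/
def pairEquiv {C : Type} {K : ℕ} (N : ℕ) (e : C ≃ Fin K) : Option (Fin N × C) ≃ Fin (N * K + 1) :=
  (Equiv.optionCongr (((Equiv.refl _).prodCongr e).trans finProdFinEquiv)).trans
    finSuccEquivLast.symm

section pairEquiv

variable {C : Type} {K N : ℕ} (e : C ≃ Fin K)

theorem pairEquiv_none : pairEquiv N e none = Fin.last _ := by
  simp [pairEquiv]

theorem pairEquiv_some (i : Fin N) (c : C) :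
    pairEquiv N e (some (i, c)) = (finProdFinEquiv (i, e c)).castSucc := by
  simp [pairEquiv]

theorem pairEquiv_none_val : (pairEquiv N e none).val = N * K := by
  simp [pairEquiv_none]

theorem pairEquiv_some_val (i : Fin N) (c : C) :
    (pairEquiv N e (some (i, c))).val = i * K + e c := by
  simp [pairEquiv_some, finProdFinEquiv, Nat.mul_comm, Nat.add_comm]

theorem range_mul (N K : ℕ) :
    List.range (N * K) = (List.range N).flatMap fun i => (List.range K).map fun c => c + K * i := by
  induction N with
  | zero => simp
  | succ N ih =>
    rw [Nat.succ_mul, List.range_add, ih, List.range_succ, List.flatMap_append]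
    simp [Nat.add_comm, Nat.mul_comm]

theorem finRange_mul (N K : ℕ) : List.finRange (N * K) =
    (List.finRange N).flatMap fun i => (List.finRange K).map fun c => finProdFinEquiv (i, c) := by
  apply List.map_injective_iff.2 Fin.val_injective
  rw [List.map_flatMap, List.map_coe_finRange_eq_range, range_mul]
  simp only [← List.map_coe_finRange_eq_range, List.flatMap_map, List.map_map]
  rfl

/-- The table is split into a loop over the cells, whose number depends on the input, and a range of
size `K`, which is fixed with the machine and can be unrolled in a term. -/
theorem flatMap_finRange_pairEquiv {g : Fin (N * K + 1) → List Bool} {h : ℕ → Fin K → List Bool}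
    {h₀ : List Bool} (hg : ∀ (i : Fin N) c, g (pairEquiv N e (some (i, e.symm c))) = h i c)
    (hg₀ : g (pairEquiv N e none) = h₀) :
    (List.finRange (N * K + 1)).flatMap g =
      ((List.range N).flatMap fun i => (List.finRange K).flatMap (h i)) ++ h₀ := by
  simp only [pairEquiv_some, Equiv.apply_symm_apply] at hg
  rw [List.finRange_succ_last, List.flatMap_append, finRange_mul]
  simp only [List.flatMap_map, List.map_flatMap, List.flatMap_assoc, ← hg₀, hg, pairEquiv_none,
    List.flatMap_singleton]
  rw [← List.map_coe_finRange_eq_range, List.flatMap_map]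

end pairEquiv

/-! ### Derived expressions and terms -/

namespace Exp

/-- The expression "if `a = b` then `t` else `e`". -/
def ifEq (a b t e : Exp) : Exp :=
  add (mul (sub (const 1) (add (sub a b) (sub b a))) t)
    (mul (sub (const 1) (sub (const 1) (add (sub a b) (sub b a)))) e)

/-- With truncated subtraction, `(a - b) + (b - a)` is the distance of `a` and `b`, and subtracting
it from 1 gives the indicator of equality. -/
theorem eval_ifEq (x : List Bool) (vars : ℕ → ℕ) (a b t e : Exp) :
    (ifEq a b t e).eval x vars =
      if a.eval x vars = b.eval x vars then t.eval x vars else e.eval x vars := by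
  simp only [ifEq, eval]
  split_ifs with h
  · simp [h]
  · have : 1 - (a.eval x vars - b.eval x vars + (b.eval x vars - a.eval x vars)) = 0 := by omega
    simp [this]

/-- Polynomials in the length of the input are values of expressions. -/
theorem exists_eval_eq (P : Polynomial ℕ) :
    ∃ e : Exp, ∀ x vars, e.eval x vars = P.eval x.length := by
  induction P using Polynomial.induction_on with
  | C a => exact ⟨const a, fun x vars => by simp [eval]⟩
  | add p q hp hq =>
    obtain ⟨e, he⟩ := hp
    obtain ⟨f, hf⟩ := hq
    exact ⟨add e f, fun x vars => by simp [eval, he, hf]⟩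
  | monomial n a h =>
    obtain ⟨e, he⟩ := h
    refine ⟨mul e len, fun x vars => ?_⟩
    rw [eval, he, eval]
    simp [pow_succ, mul_assoc]

end Exp

namespace Gen

/-- Concatenation of a list of terms. -/
def concat (l : List Gen) : Gen := l.foldr seq nil

theorem eval_concat {ι : Type} (l : List ι) (g : ι → Gen) (x : List Bool) (d : ℕ) (vars : ℕ → ℕ) :
    (concat (l.map g)).eval x d vars = l.flatMap fun i => (g i).eval x d vars := by
  induction l with
  | nil => rfl
  | cons a l ih => rw [List.flatMap_cons, ← ih]; rfl

/-- The code of a transition of an automaton `partialDPDA 0 f` for both stack symbols; the value of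
`e` is `0` if the transition is undefined, and otherwise the successor of the new state. -/
def entry (e : Exp) : Gen :=
  seq (unary (.sub e (.const 1))) (seq (unary (.sub (.const 1) (.sub (.const 1) e)))
    (seq (loop (.sub (.const 1) (.sub (.const 1) e)) (unary (.const 0)))
      (seq (unary (.const 0)) (unary (.const 0)))))

/-- The choice `z = 0` makes `e - 1` the new state even for an undefined transition. The length of
the written word is `1 - (1 - e)`, that is, 0 or 1. The two final zeros encode state 0 and the empty
word, for the stack symbol 1. -/
theorem eval_entry {nQ nA : ℕ} (f : Fin (nQ + 1) → Fin nA → Option (Fin (nQ + 1)))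
    (q : Fin (nQ + 1)) (a : Fin nA) {e : Exp} {x : List Bool} {vars : ℕ → ℕ}
    (h : e.eval x vars = (f q a).elim 0 fun q' => q'.val + 1) (d : ℕ) :
    (entry e).eval x d vars = (List.finRange 2).flatMap fun y =>
      SyncPDA.unary ((partialDPDA 0 f).δ q a y).1.val ++
        encodeWord ((partialDPDA 0 f).δ q a y).2 := by
  have h2 : List.finRange 2 = [0, 1] := rfl
  rw [h2]
  cases hf : f q a with
  | none =>
    rw [hf] at h
    simp [entry, eval, Exp.eval, h, partialDPDA, hf, encodeWord]
  | some q' =>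
    rw [hf] at h
    simp [entry, eval, Exp.eval, h, partialDPDA, hf, encodeWord]

end Gen

/-! ### The reduction -/

namespace DTM

instance (T : DTM) : Fintype T.State := T.stateFin

instance (T : DTM) : Fintype T.Symbol := T.symbolFin

variable (T : DTM)

/-- A numbering of symbols and states. -/
noncomputable def contentEquiv : T.Symbol ⊕ T.State ≃ Fin (Fintype.card (T.Symbol ⊕ T.State)) :=
  Fintype.equivFin _

/-- A numbering of pairs of states and symbols. -/
noncomputable def readEquiv : T.State × T.Symbol ≃ Fin (Fintype.card (T.State × T.Symbol)) :=
  Fintype.equivFin _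

/-- The automaton that simulates `T` on `N` cells, on numbers. -/
noncomputable def simFin (x : List Bool) (N : ℕ)
    (q : Fin (N * Fintype.card (T.Symbol ⊕ T.State) + 1))
    (a : Fin (N * Fintype.card (T.State × T.Symbol) + 1)) :
    Option (Fin (N * Fintype.card (T.Symbol ⊕ T.State) + 1)) :=
  (T.simStep x N ((pairEquiv N T.contentEquiv).symm q) ((pairEquiv N T.readEquiv).symm a)).map
    (pairEquiv N T.contentEquiv)

/-- The instance of the synchronization problem for `T` on `N` cells. -/
noncomputable def simInstance (x : List Bool) (N : ℕ) : Instance where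
  nQ := N * Fintype.card (T.Symbol ⊕ T.State) + 1
  nA := N * Fintype.card (T.State × T.Symbol) + 1
  nG := 2
  states_pos := Nat.succ_pos _
  M := partialDPDA 0 (T.simFin x N)

/-- The successor of the number of the token `(pos, c)`. -/
noncomputable def tokenExp (pos : Exp) (c : T.Symbol ⊕ T.State) : Exp :=
  .add (.mul pos (.const (Fintype.card (T.Symbol ⊕ T.State)))) (.const (T.contentEquiv c + 1))

/-- The successor of the number of the absorbing state. -/
noncomputable def sinkExp (n : Exp) : Exp :=
  .add (.mul n (.const (Fintype.card (T.Symbol ⊕ T.State)))) (.const 1)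

/-- The position after a move from the position `i`. -/
def moveExp (i : Exp) : Turing.Dir → Exp
  | .left => .sub i (.const 1)
  | .right => .add i (.const 1)

open Classical in
/-- The transition from the token `(i, c)` by the letter `(j, l)` or `none`, where `i` and `j` are
the variables `0` and `1` and the number of cells is the value of `n`. -/
noncomputable def simExp (n : Exp) : T.Symbol ⊕ T.State → Option (T.State × T.Symbol) → Exp
  | .inl _, none =>
    .ifEq (.inp (.var 0)) (.const 0) (T.tokenExp (.var 0) (.inl T.blank))
      (.ifEq (.inp (.var 0)) (.const 1) (T.tokenExp (.var 0) (.inl (T.input false)))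
        (T.tokenExp (.var 0) (.inl (T.input true))))
  | .inr _, none => T.tokenExp (.const 0) (.inr T.start)
  | .inl s', some (p, s) =>
    .ifEq (.var 0) (.var 1)
      (if s' = s then
        (T.δ p s).elim (T.sinkExp n) fun r => T.tokenExp (.var 0) (.inl r.2.1)
      else .const 0)
      ((T.δ p s).elim (T.sinkExp n) fun _ => T.tokenExp (.var 0) (.inl s'))
  | .inr p', some (p, s) =>
    .ifEq (.var 0) (.var 1)
      (if p' = p then
        match T.δ p s with
        | none => if p ∈ T.accepting then T.sinkExp n else .const 0
        | some r => .ifEq (moveExp (.var 0) r.2.2) n (.const 0)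
            (T.tokenExp (moveExp (.var 0) r.2.2) (.inr r.1))
      else .const 0)
      (.const 0)

/-- The code of the instance for `T`, where the number of cells is the value of `n`. -/
noncomputable def simGen (n : Exp) : Gen :=
  .seq (.unary (T.sinkExp n))
    (.seq (.unary (.add (.mul n (.const (Fintype.card (T.State × T.Symbol)))) (.const 1)))
    (.seq (.unary (.const 2)) (.seq (.unary (.const 0)) (.seq
      (.loop n (.concat ((List.finRange _).map fun c => .seq
        (.loop n (.concat ((List.finRange _).map fun l =>
          .entry (T.simExp n (T.contentEquiv.symm c) (some (T.readEquiv.symm l))))))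
        (.entry (T.simExp n (T.contentEquiv.symm c) none)))))
      (.seq
        (.loop n (.concat ((List.finRange (Fintype.card (T.State × T.Symbol))).map fun _ =>
          .entry (T.sinkExp n))))
        (.entry (T.sinkExp n)))))))

/-! ### The terms describe the transition table -/

variable {T} {n : Exp} {N : ℕ} {x : List Bool} {vars : ℕ → ℕ}

theorem eval_sinkExp (hn : n.eval x vars = N) :
    (T.sinkExp n).eval x vars = (pairEquiv N T.contentEquiv none).val + 1 := by
  simp [sinkExp, Exp.eval, hn, pairEquiv_none_val]

theorem eval_tokenExp {pos : Exp} {i : Fin N} (hi : pos.eval x vars = i)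
    (c : T.Symbol ⊕ T.State) :
    (T.tokenExp pos c).eval x vars = (pairEquiv N T.contentEquiv (some (i, c))).val + 1 := by
  simp [tokenExp, Exp.eval, hi, pairEquiv_some_val, Nat.add_assoc]

theorem eval_moveExp (i : Exp) (D : Turing.Dir) :
    (moveExp i D).eval x vars = moveHead D (i.eval x vars) := by
  cases D <;> rfl

/-- The value of the code of a transition. -/
noncomputable def codeOption (o : Option (Option (T.Token N))) : ℕ :=
  o.elim 0 fun t => (pairEquiv N T.contentEquiv t).val + 1

theorem eval_simExp_none {i : Fin N} (hi : vars 0 = i)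
    (c : T.Symbol ⊕ T.State) :
    (T.simExp n c none).eval x vars = codeOption (T.simStep x N (some (i, c)) none) := by
  rcases c with s | p
  · have hv : (Exp.var 0).eval x vars = i := hi
    simp only [simExp, Exp.eval_ifEq, eval_tokenExp hv, simStep, codeOption, Option.elim]
    simp only [Exp.eval, hi, init]
    cases h : x[i.val]? with
    | none => simp [bitCode]
    | some b => cases b <;> simp [bitCode]
  · simp only [simExp, simStep, codeOption, Option.elim]
    exact eval_tokenExp rfl _

theorem eval_simExp_some (hn : n.eval x vars = N) {i j : Fin N} (hi : vars 0 = i)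
    (hj : vars 1 = j) (c : T.Symbol ⊕ T.State) (l : T.State × T.Symbol) :
    (T.simExp n c (some l)).eval x vars =
      codeOption (T.simStep x N (some (i, c)) (some (j, l))) := by
  have hv : (Exp.var 0).eval x vars = i := hi
  have hw : (Exp.var 1).eval x vars = j := hj
  obtain ⟨p, s⟩ := l
  rcases c with s' | p'
  · rw [simExp, Exp.eval_ifEq, hv, hw, simStep]
    simp only [Fin.val_inj]
    by_cases hij : i = j
    · by_cases hs : s' = s
      · cases hr : T.δ p s with
        | none => simp [hij, hs, codeOption, eval_sinkExp hn]
        | some r =>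
          rw [hij] at hv
          simp [hij, hs, codeOption, eval_tokenExp hv]
      · simp [hij, hs, codeOption, Exp.eval]
    · cases hr : T.δ p s with
      | none => simp [hij, codeOption, eval_sinkExp hn]
      | some r => simp [hij, codeOption, eval_tokenExp hv]
  · rw [simExp, Exp.eval_ifEq, hv, hw, simStep]
    simp only [Fin.val_inj]
    by_cases hij : i = j
    · by_cases hp : p' = p
      · cases hr : T.δ p s with
        | none =>
          by_cases hacc : p ∈ T.accepting <;>
            simp [hij, hp, hacc, codeOption, eval_sinkExp hn, Exp.eval]
        | some r =>
          have hm : (moveExp (.var 0) r.2.2).eval x vars = moveHead r.2.2 i := by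
            rw [eval_moveExp, hv]
          -- A move changes the position by at most one, so leaving the `N` cells means arriving
          -- exactly at `N`; a test for equality suffices.
          have hle : moveHead r.2.2 i ≤ N := by
            have := i.isLt
            cases r.2.2 <;> simp only [moveHead] <;> omega
          by_cases hlt : moveHead r.2.2 i < N
          · have ht := eval_tokenExp (T := T) (i := ⟨_, hlt⟩) hm (.inr r.1)
            subst hij
            simp [hp, Exp.eval_ifEq, hm, hn, hlt, hlt.ne, ht, codeOption]
          · have : moveHead r.2.2 i = N := by omega
            subst hij
            simp [hp, Exp.eval_ifEq, hm, hn, this, codeOption, Exp.eval]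
      · simp [hij, hp, codeOption, Exp.eval]
    · simp [hij, codeOption, Exp.eval]

theorem simFin_pairEquiv (q : Option (T.Token N)) (a : Option (T.Situation N)) :
    ((T.simFin x N (pairEquiv N T.contentEquiv q) (pairEquiv N T.readEquiv a)).elim 0
      fun q' => q'.val + 1) = codeOption (T.simStep x N q a) := by
  simp only [simFin, Equiv.symm_apply_apply]
  cases T.simStep x N q a <;> rfl

/-- The value of `n` has to be independent of the variables because `n` is also evaluated inside the
loops. -/
theorem encode_simInstance (hn : ∀ vars, n.eval x vars = N) :
    (T.simInstance x N).encode = (T.simGen n).eval x 0 fun _ => 0 := by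
  have hsink : ∀ vars (a : Option (T.Situation N)),
      (T.sinkExp n).eval x vars = codeOption (T.simStep x N none a) := fun vars _ =>
    eval_sinkExp (hn vars)
  have hentry : ∀ q a d vars (e : Exp), e.eval x vars = codeOption (T.simStep x N q a) →
      ((List.finRange 2).flatMap fun y =>
        unary ((partialDPDA 0 (T.simFin x N)).δ (pairEquiv N T.contentEquiv q)
          (pairEquiv N T.readEquiv a) y).1.val ++
        encodeWord ((partialDPDA 0 (T.simFin x N)).δ (pairEquiv N T.contentEquiv q)
          (pairEquiv N T.readEquiv a) y).2) = (Gen.entry e).eval x d vars := fun q a d vars e he =>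
    (Gen.eval_entry _ _ _ (he.trans (simFin_pairEquiv q a).symm) d).symm
  simp only [Instance.encode, simGen, Gen.eval, Gen.eval_concat]
  refine congrArg₂ _ ?_ (congrArg₂ _ ?_ (congrArg₂ _ rfl (congrArg₂ _ rfl ?_)))
  · simp [sinkExp, Exp.eval, hn, simInstance]
  · simp [Exp.eval, hn, simInstance]
  · simp only [hn]
    refine flatMap_finRange_pairEquiv T.contentEquiv (fun i c => ?_) ?_
    · refine flatMap_finRange_pairEquiv T.readEquiv (fun j l => ?_) ?_
      · exact hentry _ _ _ _ _ (eval_simExp_some (hn _) (by simp) (by simp) _ _)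
      · exact hentry _ _ _ _ _ (eval_simExp_none (by simp) _)
    · refine flatMap_finRange_pairEquiv T.readEquiv (fun j l => ?_) ?_
      · exact hentry _ _ _ _ _ (hsink _ _)
      · exact hentry _ _ _ _ _ (hsink _ _)

theorem simInstance_isDCA : (T.simInstance x N).M.IsDCA := partialDPDA_isDCA

theorem simInstance_hasTurnSyncWord_iff {L : Language Bool} {s : ℕ → ℕ}
    (hT : T.DecidesInSpace L s) (model : StackModel) :
    (T.simInstance x (s x.length)).M.HasTurnSyncWord 0 model ↔ x ∈ L := by
  -- The head scans cell 0 at the start. Thus there is at least one token, and the sink, numbered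
  -- last, differs from the state 0 entered by undefined transitions.
  have hpos : 0 < s x.length := (hT x).1 _ .refl
  have hcard : 0 < Fintype.card (T.Symbol ⊕ T.State) :=
    Fintype.card_pos_iff.2 ⟨.inr T.start⟩
  rw [← exists_simStep_sync_iff hT, ← exists_partialRun_equiv (pairEquiv _ T.contentEquiv)
    (pairEquiv _ T.readEquiv)]
  refine partialDPDA_hasTurnSyncWord (f := T.simFin x (s x.length)) (fun h => ?_) (fun a => ?_)
    model
  · have := (congrArg Fin.val h).symm.trans (pairEquiv_none_val T.contentEquiv)
    exact (Nat.mul_pos hpos hcard).ne this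
  · simp [simFin, simStep]

end DTM

/-! ### PSPACE-hardness of both problems -/

/-- A language that contains the codes of the right instances is PSPACE-hard. -/
theorem pspaceHard_of_simInstance {K : Language Bool}
    (hK : ∀ {T : DTM} {L : Language Bool} {s : ℕ → ℕ}, T.DecidesInSpace L s → ∀ x : List Bool,
      x ∈ L ↔ (T.simInstance x (s x.length)).encode ∈ K) : PSPACEHard K := by
  rintro L ⟨T, p, hT⟩
  obtain ⟨n, hn⟩ := Exp.exists_eval_eq p
  refine ⟨_, (T.simGen n).polyTimeComputable, fun x => ?_⟩
  rw [← DTM.encode_simInstance (hn x)]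
  exact hK hT x

theorem pspaceHard_turnSyncDCA (model : StackModel) : PSPACEHard (TurnSyncDCA 0 model) :=
  pspaceHard_of_simInstance fun hT x => by
    rw [← DTM.simInstance_hasTurnSyncWord_iff hT model]
    constructor
    · exact fun h => ⟨_, rfl, DTM.simInstance_isDCA, h⟩
    · rintro ⟨I, hI, -, h⟩
      rwa [← Instance.encode_injective hI]

theorem pspaceHard_turnSyncDPDA (model : StackModel) : PSPACEHard (TurnSyncDPDA 0 model) :=
  pspaceHard_of_simInstance fun hT x => by
    rw [← DTM.simInstance_hasTurnSyncWord_iff hT model]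
    constructor
    · exact fun h => ⟨_, rfl, h⟩
    · rintro ⟨I, hI, h⟩
      rwa [← Instance.encode_injective hI]

end SyncPDA

theorem mainTheorem6 :
    (SyncPDA.PSPACEHard (SyncPDA.TurnSyncDCA 0 .empty) ∧
      SyncPDA.PSPACEHard (SyncPDA.TurnSyncDCA 0 .same) ∧
      SyncPDA.PSPACEHard (SyncPDA.TurnSyncDCA 0 .arbitrary)) ∧
    (SyncPDA.PSPACEHard (SyncPDA.TurnSyncDPDA 0 .empty) ∧
      SyncPDA.PSPACEHard (SyncPDA.TurnSyncDPDA 0 .same) ∧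
      SyncPDA.PSPACEHard (SyncPDA.TurnSyncDPDA 0 .arbitrary)) :=
  ⟨⟨SyncPDA.pspaceHard_turnSyncDCA _, SyncPDA.pspaceHard_turnSyncDCA _,
    SyncPDA.pspaceHard_turnSyncDCA _⟩, SyncPDA.pspaceHard_turnSyncDPDA _,
    SyncPDA.pspaceHard_turnSyncDPDA _, SyncPDA.pspaceHard_turnSyncDPDA _⟩
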